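/- Let $\alpha,\beta\ge 0$ be densities of finite mass supported on $\mathbb R_+$ such that all bimoments $\iint_{\mathbb R_+^2} x^iy^j\frac{\alpha(x)\beta(y)}{x+y}\,dx\,dy$ are finite. Let $p_j,q_j$ ($j\ge 0$) be the Cauchy biorthogonal polynomials: $\deg p_j=\deg q_j=j$, the leading coefficients of $p_j$ and $q_j$ are equal and positive, and $\iint_{\mathbb R_+^2} p_j(x)q_k(y)\frac{\alpha(x)\beta(y)}{x+y}\,dx\,dy=\delta_{jk}$. For $N\in\mathbb N$ and $x,x',y,y'>0$ define the kernels (those of the correlation functions of the Cauchy two-matrix model of size $N$) $$H_{00}(x,y)=\sum_{j=0}^{N-1}p_j(x)q_j(y),\qquad H_{01}(x,x')=\int_{\mathbb R_+} \frac{H_{00}(x,y)\,\beta(y)\,dy}{x'+y},\qquad H_{10}(y,y')=\int_{\mathbb R_+} \frac{H_{00}(x,y')\,\alpha(x)\,dx}{x+y},$$ $$H_{11}(y,x)=\iint_{\mathbb R_+^2} \frac{H_{00}(z,w)\,\alpha(z)\beta(w)\,dz\,dw}{(z+y)(x+w)}-\frac1{x+y}.$$ Put $p_j^{(0)}=p_j$,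 $q_j^{(0)}=q_j$, $p_j^{(1)}(z)=\int_{\mathbb R_+}\frac{p_j(\xi)\alpha(\xi)d\xi}{z-\xi}$, $q_j^{(1)}(w)=\int_{\mathbb R_+}\frac{q_j(\zeta)\beta(\zeta)d\zeta}{w-\zeta}$, and for $\mu,\nu\in\{0,1\}$ $$\mathbb H_{N,\mu\nu}(z,w)=\sum_{j=0}^{N-1}q_j^{(\mu)}(w)\,p_j^{(\nu)}(z)+\frac{\delta_{\mu1}\delta_{\nu1}}{z+w}.$$ Let $\beta^\star(x)=\beta(-x)$ and let $\widehat\Gamma$ be a solution of the following $3\times3$ Riemann–Hilbert problem: (1) $\widehat\Gamma$ is analytic on $\Omega=\mathbb C\setminus(\operatorname{supp}\alpha\cup\operatorname{supp}\beta^\star)$; (2) $\widehat\Gamma_+=\widehat\Gamma_-V$ on $\mathbb R$ with $$V=\begin{bmatrix}1&-2\pi i\,\alpha&0\\0&1&-2\pi i\,\beta^\star\\0&0&1\end{bmatrix},$$ in the weak sense: $\|\widehat\Gamma(z)\|\le C(1+|z|)^k(1+|\operatorname{Im}z|^{-1})^m$ off the real axis for some $C,k,m$, and $\int_{\mathbb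 R}\varphi(x)\big[\widehat\Gamma(x+i\varepsilon)-\widehat\Gamma(x-i\varepsilon)V(x)\big]dx\to0$ as $\varepsilon\downarrow0$ for every $\varphi\in C_c^\infty(\mathbb R)$; (3) $\widehat\Gamma(z)=\big(\mathbf 1+\mathcal O(1/z)\big)\operatorname{diag}(z^N,1,z^{-N})$ as $z\to\infty$ in each double sector $|\operatorname{Im} z|\ge\delta|z|$, $\delta>0$. Then for all $x,x',y,y'>0$ $$\begin{aligned} H_{00}(x,y)&=\mathbb H_{N,00}(x,y)=\frac{[\widehat\Gamma^{-1}(-y)\widehat\Gamma(x)]_{3,1}}{x+y},& H_{10}(y',y)&=-\mathbb H_{N,01}(-y',y)=\frac{[\widehat\Gamma^{-1}(-y)\widehat\Gamma(-y')]_{3,2}}{y'-y},\\ H_{01}(x,x')&=-\mathbb H_{N,10}(x,-x')=\frac{[\widehat\Gamma^{-1}(x')\widehat\Gamma(x)]_{2,1}}{x'-x},& H_{11}(y,x)&=\mathbb H_{N,11}(-y,-x)=-\frac{[\widehat\Gamma^{-1}(x)\widehat\Gamma(-y)]_{2,2}}{x+y}. \end{aligned}$$ Here each quotient, which is defined for pairs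 of distinct arguments of $\widehat\Gamma^{-1}$ and $\widehat\Gamma$ in $\Omega$, is understood as its limit from within such pairs when an argument lies on a support or when the two arguments coincide; these limits exist. -/

import Mathlib

open MeasureTheory Filter Topology Asymptotics Polynomial
open scoped ContDiff

namespace CauchyTwoMatrix

noncomputable section

/-- `α`, `β` are nonnegative densities of finite mass, supported on the positive half-line, for
which all bimoments with respect to the Cauchy kernel `1 / (x + y)` are finite. -/
structure IsDensityPair (α β : ℝ → ℝ) : Prop where
  nonneg_left : ∀ x, 0 ≤ α x
  nonneg_right : ∀ y, 0 ≤ β y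
  supp_left : ∀ x < 0, α x = 0
  supp_right : ∀ y < 0, β y = 0
  integrable_left : Integrable α
  integrable_right : Integrable β
  bimoments : ∀ i j : ℕ, Integrable
    (fun P : ℝ × ℝ => P.1 ^ i * P.2 ^ j / (P.1 + P.2) * (α P.1 * β P.2))

/-- The Cauchy biorthogonal polynomials: `p j` and `q j` have exact degree `j`, the same positive
leading coefficient, and are biorthonormal for `α(x) β(y) dx dy / (x + y)`. -/
structure IsCauchyBOP (α β : ℝ → ℝ) (p q : ℕ → ℝ[X]) : Prop where
  natDegree_left : ∀ j, (p j).natDegree = j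
  natDegree_right : ∀ j, (q j).natDegree = j
  leadingCoeff_pos : ∀ j, 0 < (p j).leadingCoeff
  leadingCoeff_eq : ∀ j, (p j).leadingCoeff = (q j).leadingCoeff
  biorthonormal : ∀ j k, ∫ x in Set.Ioi (0 : ℝ), ∫ y in Set.Ioi (0 : ℝ),
    (p j).eval x * (q k).eval y / (x + y) * (α x * β y) = if j = k then 1 else 0

/-! ### The kernels of the correlation functions -/

/-- `H₀₀(x, y) = 𝕂_N(x, y) = ∑_{j < N} p_j(x) q_j(y)`. -/
def H00 (p q : ℕ → ℝ[X]) (N : ℕ) (x y : ℝ) : ℝ :=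
  ∑ j ∈ Finset.range N, (p j).eval x * (q j).eval y

/-- `H₀₁(x, x') = ∫ H₀₀(x, y) β(y) dy / (x' + y)`. -/
def H01 (β : ℝ → ℝ) (p q : ℕ → ℝ[X]) (N : ℕ) (x x' : ℝ) : ℝ :=
  ∫ y in Set.Ioi (0 : ℝ), H00 p q N x y * β y / (x' + y)

/-- `H₁₀(y, y') = ∫ H₀₀(x, y') α(x) dx / (x + y)`. -/
def H10 (α : ℝ → ℝ) (p q : ℕ → ℝ[X]) (N : ℕ) (y y' : ℝ) : ℝ :=
  ∫ x in Set.Ioi (0 : ℝ), H00 p q N x y' * α x / (x + y)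

/-- `H₁₁(y, x) = ∬ H₀₀(z, w) α(z) dz β(w) dw / ((z + y) (x + w)) - 1 / (x + y)`. -/
def H11 (α β : ℝ → ℝ) (p q : ℕ → ℝ[X]) (N : ℕ) (y x : ℝ) : ℝ :=
  (∫ z in Set.Ioi (0 : ℝ), ∫ w in Set.Ioi (0 : ℝ),
    H00 p q N z w * (α z * β w) / ((z + y) * (x + w))) - 1 / (x + y)

/-! ### The Christoffel-Darboux matrix kernel -/

/-- For a polynomial `f` and a density `ρ`: `f^{(0)}(z) = f(z)` and
`f^{(1)}(z) = ∫ f(ξ) ρ(ξ) dξ / (z - ξ)`. -/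
def transform (ρ : ℝ → ℝ) (f : ℝ[X]) (μ : Fin 2) (z : ℂ) : ℂ :=
  match μ with
  | 0 => aeval z f
  | 1 => ∫ ξ in Set.Ioi (0 : ℝ), ((f.eval ξ * ρ ξ : ℝ) : ℂ) / (z - (ξ : ℂ))

/-- The principal `2 × 2` block (indices `μ, ν = 0, 1`) of the matrix kernel:
`ℍ_{N, μν}(z, w) = ∑_{j < N} q_j^{(μ)}(w) p_j^{(ν)}(z) + 𝔽_{μν} / (z + w)`, where the block of `𝔽`
is constant, with `𝔽₁₁ = 1` as its only nonzero entry. -/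
def matrixKernel (α β : ℝ → ℝ) (p q : ℕ → ℝ[X]) (N : ℕ) (z w : ℂ) : Matrix (Fin 2) (Fin 2) ℂ :=
  Matrix.of fun μ ν =>
    ∑ j ∈ Finset.range N, transform β (q j) μ w * transform α (p j) ν z
      + (!![0, 0; 0, 1] : Matrix (Fin 2) (Fin 2) ℂ) μ ν / (z + w)

/-! ### The Riemann-Hilbert problem -/

/-- The reflected density `ρ*(x) = ρ(-x)`. -/
def reflected (ρ : ℝ → ℝ) (x : ℝ) : ℝ := ρ (-x)

/-- `ℂ \ (supp α ∪ supp β*)`. -/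
def offSupports (α β : ℝ → ℝ) : Set ℂ :=
  ((fun t : ℝ => (t : ℂ)) '' (tsupport α ∪ tsupport (reflected β)))ᶜ

/-- The jump matrix on the real line: it is `1 - 2πi α E₁₂` on the positive and `1 - 2πi β* E₂₃` on
the negative half-line (and the identity off the supports). -/
def jumpMatrix (α β : ℝ → ℝ) (x : ℝ) : Matrix (Fin 3) (Fin 3) ℂ :=
  !![1, -2 * (Real.pi : ℂ) * Complex.I * (α x : ℂ), 0;
     0, 1, -2 * (Real.pi : ℂ) * Complex.I * (reflected β x : ℂ);
     0, 0, 1]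

/-- `Γ` solves the `3 × 3` Riemann-Hilbert problem with parameter `n`. For general densities
pointwise boundary values need not exist, so the jump relation `Γ₊ = Γ₋ V` is understood weakly,
against test functions, for functions of slow growth (the class of functions that have tempered
boundary values). The asymptotic relation `Γ(z) = (1 + O(1/z)) diag(zⁿ, 1, z⁻ⁿ)` is required
as `z → ∞` away from the real axis, i.e. in every double sector `|Im z| ≥ δ |z|`.
The values of `Γ` on the supports are irrelevant. -/
structure IsRHPSolution (α β : ℝ → ℝ) (n : ℕ) (Γ : ℂ → Matrix (Fin 3) (Fin 3) ℂ) : Prop where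
  analytic : ∀ i j, DifferentiableOn ℂ (fun z => Γ z i j) (offSupports α β)
  slowGrowth : ∃ (C : ℝ) (k m : ℕ), ∀ z : ℂ, z.im ≠ 0 → ∀ i j,
    ‖Γ z i j‖ ≤ C * (1 + ‖z‖) ^ k * (1 + |z.im|⁻¹) ^ m
  jump : ∀ φ : ℝ → ℂ, ContDiff ℝ ∞ φ → HasCompactSupport φ → ∀ i j,
    Tendsto
      (fun ε : ℝ => ∫ x : ℝ, φ x *
        (Γ ((x : ℂ) + (ε : ℂ) * Complex.I)
          - Γ ((x : ℂ) - (ε : ℂ) * Complex.I) * jumpMatrix α β x) i j)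
      (𝓝[>] 0) (𝓝 0)
  asymptotics : ∀ δ : ℝ, 0 < δ → ∀ i j,
    (fun z : ℂ => (Γ z * Matrix.diagonal ![(z ^ n)⁻¹, 1, z ^ n] - 1) i j)
      =O[Bornology.cobounded ℂ ⊓ 𝓟 {z : ℂ | δ * ‖z‖ ≤ |z.im|}] (fun z : ℂ => z⁻¹)

/-- `G(a, b) = L`, where `G` is defined at pairs of distinct points off the supports, and its value
at `(a, b)` is the common boundary value (limit from all sides) if `a` or `b` lies on a support, or
if `a = b`. When `a ≠ b` are both off the supports, this forces `G a b = L`. -/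
def HasValue (α β : ℝ → ℝ) (G : ℂ → ℂ → ℂ) (a b L : ℂ) : Prop :=
  Tendsto (fun P : ℂ × ℂ => G P.1 P.2)
    (𝓝[{P : ℂ × ℂ | P.1 ∈ offSupports α β ∧ P.2 ∈ offSupports α β ∧ P.1 ≠ P.2}] (a, b)) (𝓝 L)

end

end CauchyTwoMatrix

/-! The columns of a solution are recovered from the jump one after another, and the relevant rows
of its inverse are cross products of these columns. Write C[ρ](z) = ∫ ρ(t) dt / (z - t).

The analytic core is `exists_polynomial_of_weak_no_jump`: a function of slow growth, holomorphic off
ℝ and without weak jump, is a polynomial. Convolution with a test function along ℝ lowers the order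
of the singularity at ℝ until none is left. The smeared function then extends continuously across ℝ,
is entire by Morera and a polynomial by Liouville, of a degree that does not depend on the test
function; an approximate identity returns to the original function. So the first column is a
polynomial vector P. Since C[ρ] has weak jump -2πi ρ, the triangular form of V makes the second
column M = e₂ + C[P α] and the third L = R + C[M β*] with R polynomial. For the third jump it
matters that α and β* live on opposite half-lines, so that M is continuous at almost every point
where β* does not vanish. The normalization is only used along the positive imaginary axis.

The cross product W = P × M has no Cauchy part, hence is polynomial. Likewise W · L is polynomial,
with limit 1 on the imaginary axis, so det Γ = 1 and W is the third row of Γ⁻¹. The same reasoning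
gives L × P = e₂ - C[W β*] for the second row.

The polynomial z ↦ W(w) · P(z) vanishes at z = w, so it is (z - w) K(z) with deg K < N, and W(w) ·
M(z) = (z - w) C[K α](z) (`IsNormalized.exists_quotient`). Pairing C[K α] with q_k(-t) β*(t) for k <
N gives minus the coefficient of p_k in K by biorthogonality, and -q_k(-w) by W · L = 1. Hence K(z)
= ∑ q_j(-w) p_j(z) (`IsNormalized.sum_mul_first_and_middle`), a Christoffel-Darboux identity. The
second row is obtained by a Cauchy transform in w, where det Γ = 1 produces the term -1/(x + y) of
H₁₁. After division by z - w every entry is an expression continuous at the required point, so all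
the limits exist. -/

namespace CauchyTwoMatrix

noncomputable section

/-! ### Functions of slow growth without jump are polynomials -/

/-- Convolution of `f` with `φ` along the real direction. -/
def smear (φ : ℝ → ℂ) (f : ℂ → ℂ) (z : ℂ) : ℂ := ∫ t : ℝ, φ t * f (z - t)

theorem isOpen_im_ne_zero : IsOpen {z : ℂ | z.im ≠ 0} :=
  isOpen_ne_fun Complex.continuous_im continuous_const

theorem dense_im_ne_zero : Dense {z : ℂ | z.im ≠ 0} := by
  intro z
  rw [Metric.mem_closure_iff]
  intro ε hε
  by_cases hz : z.im = 0
  · refine ⟨z + (ε / 2 : ℝ) * Complex.I, by simp [hz, hε.ne'], ?_⟩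
    rw [dist_eq_norm]
    simp [abs_of_pos hε, hε]
  · exact ⟨z, hz, by simpa using hε⟩

theorem continuous_comp_sub_ofReal {f : ℂ → ℂ} (hf : ContinuousOn f {z : ℂ | z.im ≠ 0}) {z : ℂ}
    (hz : z.im ≠ 0) : Continuous fun t : ℝ => f (z - t) :=
  hf.comp_continuous (by fun_prop) (by simpa using hz)

/-- Integration by parts moves the derivative from `f` to `φ`. A derivative of a smeared function is
thus again a smeared function and costs no further power of 1 / |Im z|. -/
theorem hasDerivAt_smear {f : ℂ → ℂ} (hf : DifferentiableOn ℂ f {z : ℂ | z.im ≠ 0}) {φ : ℝ → ℂ}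
    (hφ : ContDiff ℝ ∞ φ) (hc : HasCompactSupport φ) {z : ℂ} (hz : z.im ≠ 0) :
    HasDerivAt (smear φ f) (smear (deriv φ) f z) z := by
  have hf' : ContinuousOn (deriv f) {z : ℂ | z.im ≠ 0} :=
    (hf.deriv isOpen_im_ne_zero).continuousOn
  have hd : ∀ w : ℂ, w.im ≠ 0 → HasDerivAt f (deriv f w) w := fun w hw =>
    (hf.differentiableAt (isOpen_im_ne_zero.mem_nhds hw)).hasDerivAt
  have hint : ∀ (ψ : ℝ → ℂ) (g : ℂ → ℂ), Continuous ψ → HasCompactSupport ψ →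
      ContinuousOn g {z : ℂ | z.im ≠ 0} → ∀ w : ℂ, w.im ≠ 0 →
      Integrable fun t : ℝ => ψ t * g (w - t) := fun ψ g hψ hψc hg w hw =>
    (hψ.mul (continuous_comp_sub_ofReal hg hw)).integrable_of_hasCompactSupport hψc.mul_right
  -- This radius keeps the closed disc in one open half-plane, so `deriv f` is bounded on the
  -- compact set of all `w - t` with `t` in the support.
  have hr : 0 < |z.im| / 2 := by positivity
  have him : ∀ w ∈ Metric.closedBall z (|z.im| / 2), w.im ≠ 0 := by
    intro w hw h0
    have h1 : |z.im - w.im| ≤ |z.im| / 2 := by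
      rw [Metric.mem_closedBall, dist_comm, dist_eq_norm] at hw
      simpa using (Complex.abs_im_le_norm (z - w)).trans hw
    rw [h0, sub_zero] at h1
    have := abs_pos.2 hz
    linarith
  obtain ⟨M, hM⟩ : ∃ M, ∀ w ∈ Metric.closedBall z (|z.im| / 2), ∀ t ∈ tsupport φ,
      ‖deriv f (w - t)‖ ≤ M := by
    have hK : IsCompact (Metric.closedBall z (|z.im| / 2) ×ˢ tsupport φ) :=
      (isCompact_closedBall _ _).prod hc
    obtain ⟨M, hM⟩ := hK.exists_bound_of_continuousOn (f := fun P : ℂ × ℝ => deriv f (P.1 - P.2))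
      (hf'.comp (by fun_prop) fun P hP => by simpa using him P.1 hP.1)
    exact ⟨M, fun w hw t ht => hM (w, t) ⟨hw, ht⟩⟩
  have key := hasDerivAt_integral_of_dominated_loc_of_deriv_le (μ := volume)
    (F := fun (w : ℂ) (t : ℝ) => φ t * f (w - t)) (F' := fun w t => φ t * deriv f (w - t))
    (bound := fun t => ‖φ t‖ * M) (x₀ := z) (s := Metric.closedBall z (|z.im| / 2))
    (Metric.closedBall_mem_nhds z hr) ?_ (hint φ f hφ.continuous hc hf.continuousOn z hz)
    (hint φ _ hφ.continuous hc hf' z hz).aestronglyMeasurable ?_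
    ((hφ.continuous.integrable_of_hasCompactSupport hc).norm.mul_const M) ?_
  · suffices h : smear (deriv φ) f z = ∫ t : ℝ, φ t * deriv f (z - t) by
      rw [h]
      exact key.2
    have hp := integral_mul_deriv_eq_deriv_mul_of_integrable (u := φ) (u' := deriv φ)
      (v := fun t : ℝ => f (z - t)) (v' := fun t : ℝ => -deriv f (z - t))
      (fun t _ => (hφ.differentiable (by simp) t).hasDerivAt) (fun t _ => ?_) ?_ ?_ ?_
    · simp only [mul_neg, integral_neg, neg_inj] at hp
      exact hp.symm
    · have h1 : HasDerivAt (fun t : ℝ => z - (t : ℂ)) (-1) t := by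
        simpa using (Complex.ofRealCLM.hasDerivAt (x := t)).const_sub z
      have := (hd (z - t) (by simpa using hz)).comp t h1
      simpa using! this
    · simpa [Pi.mul_def] using! (hint φ _ hφ.continuous hc hf' z hz).neg
    · exact hint _ f (hφ.continuous_deriv (by simp)) hc.deriv hf.continuousOn z hz
    · exact hint φ f hφ.continuous hc hf.continuousOn z hz
  · filter_upwards [Metric.closedBall_mem_nhds z hr] with w hw
    exact (hint φ f hφ.continuous hc hf.continuousOn w (him w hw)).aestronglyMeasurable
  · refine Eventually.of_forall fun t w hw => ?_
    rw [norm_mul]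
    by_cases ht : t ∈ tsupport φ
    · gcongr
      exact hM w hw t ht
    · simp [image_eq_zero_of_notMem_tsupport ht]
  · refine Eventually.of_forall fun t w hw => ?_
    have := (hd (w - t) (by simpa using him w hw)).comp w ((hasDerivAt_id w).sub_const (t : ℂ))
    simpa using! this.const_mul (φ t)

/-- The smeared function inherits the growth of the function. -/
theorem norm_smear_le {f : ℂ → ℂ} {C : ℝ} {k m : ℕ} (hC : 0 ≤ C)
    (hb : ∀ z : ℂ, z.im ≠ 0 → ‖f z‖ ≤ C * (1 + ‖z‖) ^ k * (1 + |z.im|⁻¹) ^ m) {φ : ℝ → ℂ}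
    (hφ : Continuous φ) (hc : HasCompactSupport φ) :
    ∃ A : ℝ, 0 ≤ A ∧ ∀ z : ℂ, z.im ≠ 0 →
      ‖smear φ f z‖ ≤ A * (1 + ‖z‖) ^ k * (1 + |z.im|⁻¹) ^ m := by
  obtain ⟨T, hT0, hT⟩ : ∃ T : ℝ, 0 ≤ T ∧ ∀ t ∈ tsupport φ, |t| ≤ T := by
    obtain ⟨T, hT⟩ := IsCompact.exists_bound_of_continuousOn hc continuousOn_id
    exact ⟨max T 0, le_max_right _ _, fun t ht => (hT t ht).trans (le_max_left _ _)⟩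
  refine ⟨C * (1 + T) ^ k * ∫ t, ‖φ t‖, by positivity, fun z hz => ?_⟩
  have h1 : ∀ t : ℝ, ‖φ t * f (z - t)‖ ≤
      ‖φ t‖ * (C * ((1 + T) * (1 + ‖z‖)) ^ k * (1 + |z.im|⁻¹) ^ m) := by
    intro t
    rw [norm_mul]
    by_cases ht : t ∈ tsupport φ
    · have h2 := hb (z - t) (by simpa using hz)
      have h3 : 1 + ‖z - t‖ ≤ (1 + T) * (1 + ‖z‖) := by
        have h4 := norm_sub_le z (t : ℂ)
        have h5 := hT t ht
        have h6 : ‖(t : ℂ)‖ = |t| := by simp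
        nlinarith [norm_nonneg z, mul_nonneg hT0 (norm_nonneg z)]
      have h4 : (z - t).im = z.im := by simp
      rw [h4] at h2
      refine mul_le_mul_of_nonneg_left (h2.trans ?_) (norm_nonneg _)
      gcongr
    · simp [image_eq_zero_of_notMem_tsupport ht]
  refine (norm_integral_le_of_norm_le ((hφ.integrable_of_hasCompactSupport hc).norm.mul_const _)
    (Eventually.of_forall h1)).trans (le_of_eq ?_)
  rw [integral_mul_const, mul_pow]
  ring

/-- Smearing removes the singularity at the real line one order at a time. -/
theorem norm_smear_le_of_succ {f : ℂ → ℂ} (hf : DifferentiableOn ℂ f {z : ℂ | z.im ≠ 0})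
    {k s : ℕ} (hb : ∀ φ : ℝ → ℂ, ContDiff ℝ ∞ φ → HasCompactSupport φ →
      ∃ A : ℝ, 0 ≤ A ∧ ∀ z : ℂ, z.im ≠ 0 →
        ‖smear φ f z‖ ≤ A * (1 + ‖z‖) ^ k * (1 + |z.im|⁻¹) ^ (s + 1))
    (φ : ℝ → ℂ) (hφ : ContDiff ℝ ∞ φ) (hc : HasCompactSupport φ) :
    ∃ A : ℝ, 0 ≤ A ∧ ∀ z : ℂ, z.im ≠ 0 →
        ‖smear φ f z‖ ≤ A * (1 + ‖z‖) ^ k * (1 + |z.im|⁻¹) ^ s := by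
  have hφ1 : ContDiff ℝ ∞ (deriv φ) := (contDiff_infty_iff_deriv.1 hφ).2
  have hφ2 : ContDiff ℝ ∞ (deriv (deriv φ)) := (contDiff_infty_iff_deriv.1 hφ1).2
  obtain ⟨A0, hA0, hb0⟩ := hb φ hφ hc
  obtain ⟨A1, hA1, hb1⟩ := hb _ hφ1 hc.deriv
  obtain ⟨A2, hA2, hb2⟩ := hb _ hφ2 hc.deriv.deriv
  -- The first term bounds the value and the first derivative at height one, the second the
  -- second-order Taylor remainder.
  refine ⟨(A0 + A1) * 2 ^ k * 2 ^ (s + 1) + 2 * A2 * 2 ^ k, by positivity, fun z hz => ?_⟩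
  have hy := abs_pos.2 hz
  have hk1 : (1 : ℝ) ≤ 2 ^ k := one_le_pow₀ (by norm_num)
  have hs1 : (1 : ℝ) ≤ (1 + |z.im|⁻¹) ^ s := one_le_pow₀ (by simp)
  rcases le_or_gt 1 |z.im| with h1 | h1
  · have h2 : (1 + |z.im|⁻¹) ^ (s + 1) ≤ 2 ^ (s + 1) := by
      have := inv_le_one_of_one_le₀ h1
      gcongr
      linarith
    calc ‖smear φ f z‖ ≤ A0 * (1 + ‖z‖) ^ k * (1 + |z.im|⁻¹) ^ (s + 1) := hb0 z hz
      _ ≤ A0 * (1 + ‖z‖) ^ k * 2 ^ (s + 1) := by gcongr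
      _ = (A0 * 1 * 2 ^ (s + 1)) * (1 + ‖z‖) ^ k * 1 := by ring
      _ ≤ _ := by
        gcongr
        have : A0 * 1 * 2 ^ (s + 1) ≤ (A0 + A1) * 2 ^ k * 2 ^ (s + 1) := by
          gcongr
          linarith
        have : 0 ≤ 2 * A2 * 2 ^ k := by positivity
        linarith
  · obtain ⟨σ, hσ, hσz⟩ : ∃ σ : ℝ, (σ = 1 ∨ σ = -1) ∧ |z.im| = σ * z.im := by
      rcases lt_or_gt_of_ne hz with h | h
      · exact ⟨-1, Or.inr rfl, by rw [abs_of_neg h]; ring⟩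
      · exact ⟨1, Or.inl rfl, by rw [abs_of_pos h]; ring⟩
    have hσ2 : σ * σ = 1 := by rcases hσ with rfl | rfl <;> norm_num
    have hσa : |σ| = 1 := by rcases hσ with rfl | rfl <;> norm_num
    -- The vertical segment from height one down to `z`, in the half-plane of `z`; `σ` is the sign
    -- of `z.im`.
    set S : Set ℂ := {w | w.re = z.re ∧ |z.im| ≤ σ * w.im ∧ σ * w.im ≤ 1} with hS
    have habs : ∀ w ∈ S, |w.im| = σ * w.im := by
      intro w hw
      have h3 : |σ * w.im| = σ * w.im := abs_of_pos (hy.trans_le hw.2.1)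
      rwa [abs_mul, hσa, one_mul] at h3
    have hne : ∀ w ∈ S, w.im ≠ 0 := fun w hw => abs_pos.1 (by
      rw [habs w hw]; exact hy.trans_le hw.2.1)
    have hdist : ∀ w ∈ S, ‖z - w‖ = |w.im| - |z.im| := by
      intro w hw
      have h3 : z - w = ((z.im - w.im : ℝ) : ℂ) * Complex.I := by
        apply Complex.ext <;> simp [hw.1]
      have h4 : |σ * (z.im - w.im)| = |w.im| - |z.im| := by
        have h5 := hw.2.1
        rw [hσz] at h5
        rw [habs w hw, hσz, abs_of_nonpos] <;> linarith
      rw [abs_mul, hσa, one_mul] at h4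
      rw [h3, norm_mul, Complex.norm_I, mul_one, Complex.norm_real, Real.norm_eq_abs, h4]
    have hconv : Convex ℝ S := by
      intro u hu v hv a b ha hb hab
      refine ⟨?_, ?_, ?_⟩
      · simp only [Complex.add_re, Complex.smul_re, hu.1, hv.1, smul_eq_mul]
        rw [← add_mul, hab, one_mul]
      · simp only [Complex.add_im, Complex.smul_im, smul_eq_mul]
        have := mul_le_mul_of_nonneg_left hu.2.1 ha
        have := mul_le_mul_of_nonneg_left hv.2.1 hb
        have h5 : a * |z.im| + b * |z.im| = |z.im| := by rw [← add_mul, hab, one_mul]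
        linarith
      · simp only [Complex.add_im, Complex.smul_im, smul_eq_mul]
        have := mul_le_mul_of_nonneg_left hu.2.2 ha
        have := mul_le_mul_of_nonneg_left hv.2.2 hb
        linarith
    have hnorm : ∀ w ∈ S, 1 + ‖w‖ ≤ 2 * (1 + ‖z‖) := by
      intro w hw
      have h3 : ‖w‖ ≤ ‖z‖ + ‖z - w‖ := by
        rw [norm_sub_rev]; simpa using norm_add_le z (w - z)
      have h4 := hdist w hw
      have h5 := hw.2.2
      rw [← habs w hw] at h5
      linarith [norm_nonneg z]
    set z1 : ℂ := ⟨z.re, σ⟩ with hz1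
    have hz1S : z1 ∈ S := ⟨rfl, by simp only [hz1]; rw [hσ2]; exact h1.le, by simp [hz1, hσ2]⟩
    have hzS : z ∈ S := ⟨rfl, hσz.le, hσz ▸ h1.le⟩
    -- In this first-order Taylor polynomial, seen as a function of its base point, the first
    -- derivatives cancel and (z - w) times the second derivative remains. On the segment |z - w| ≤
    -- |Im w|, so this factor cancels one power of 1 / |Im w|. Integrating the first derivative
    -- alone would leave a logarithm in the last step.
    have hmv := hconv.norm_image_sub_le_of_norm_hasDerivWithin_le
      (f := fun w => smear φ f w + (z - w) * smear (deriv φ) f w)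
      (f' := fun w => (z - w) * smear (deriv (deriv φ)) f w)
      (C := 2 * A2 * 2 ^ k * (1 + ‖z‖) ^ k * (1 + |z.im|⁻¹) ^ s) ?_ ?_ hz1S hzS
    · have h3 : ‖z - z1‖ ≤ 1 := by
        rw [hdist z1 hz1S]
        have : |z1.im| = 1 := hσa
        linarith
      have hi1 : |z1.im|⁻¹ = 1 := by simp [hz1, hσa]
      have hb0' := hb0 z1 (hne z1 hz1S)
      have hb1' := hb1 z1 (hne z1 hz1S)
      rw [hi1, one_add_one_eq_two] at hb0' hb1'
      have hn1 : (1 + ‖z1‖) ^ k ≤ 2 ^ k * (1 + ‖z‖) ^ k := by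
        rw [← mul_pow]; exact pow_le_pow_left₀ (by positivity) (hnorm z1 hz1S) k
      simp only [sub_self, zero_mul, add_zero] at hmv
      set B : ℝ := 2 * A2 * 2 ^ k * (1 + ‖z‖) ^ k * (1 + |z.im|⁻¹) ^ s with hB
      have hB0 : 0 ≤ B := by positivity
      have h4 : ‖smear φ f z‖ ≤ ‖smear φ f z1‖ + ‖z - z1‖ * ‖smear (deriv φ) f z1‖ + B := by
        set X := smear φ f z
        set Y := smear φ f z1 + (z - z1) * smear (deriv φ) f z1 with hY
        have h5 : ‖X‖ ≤ ‖Y‖ + ‖X - Y‖ := by simpa using norm_add_le Y (X - Y)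
        have h6 : ‖Y‖ ≤ ‖smear φ f z1‖ + ‖z - z1‖ * ‖smear (deriv φ) f z1‖ := by
          rw [← norm_mul]; exact norm_add_le _ _
        have h7 : B * ‖z - z1‖ ≤ B * 1 := by gcongr
        linarith
      have h8 : ‖z - z1‖ * ‖smear (deriv φ) f z1‖ ≤ 1 * ‖smear (deriv φ) f z1‖ := by gcongr
      have h9 : (A0 + A1) * (1 + ‖z1‖) ^ k * 2 ^ (s + 1) ≤
          (A0 + A1) * (2 ^ k * (1 + ‖z‖) ^ k) * 2 ^ (s + 1) := by gcongr
      have h10 : (A0 + A1) * (2 ^ k * (1 + ‖z‖) ^ k) * 2 ^ (s + 1) * 1 ≤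
          (A0 + A1) * (2 ^ k * (1 + ‖z‖) ^ k) * 2 ^ (s + 1) * (1 + |z.im|⁻¹) ^ s := by gcongr
      rw [hB] at h4
      linarith
    · intro w hw
      have hd0 := hasDerivAt_smear hf hφ hc (hne w hw)
      have hd1 := hasDerivAt_smear hf hφ1 hc.deriv (hne w hw)
      have := hd0.add (((hasDerivAt_id w).const_sub z).mul hd1)
      refine HasDerivAt.hasDerivWithinAt ?_
      convert! this using 1
      simp
    · intro w hw
      rw [norm_mul]
      have hw0 := abs_pos.2 (hne w hw)
      have hzw : |z.im| ≤ |w.im| := by rw [habs w hw]; exact hw.2.1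
      have hw1 : |w.im| ≤ 1 := by rw [habs w hw]; exact hw.2.2
      have h3 : ‖z - w‖ ≤ |w.im| := by rw [hdist w hw]; linarith
      calc ‖z - w‖ * ‖smear (deriv (deriv φ)) f w‖
          ≤ |w.im| * (A2 * (1 + ‖w‖) ^ k * (1 + |w.im|⁻¹) ^ (s + 1)) := by
            gcongr
            exact hb2 w (hne w hw)
        _ = (|w.im| + |w.im| * |w.im|⁻¹) * A2 * (1 + ‖w‖) ^ k * (1 + |w.im|⁻¹) ^ s := by ring
        _ = (|w.im| + 1) * A2 * (1 + ‖w‖) ^ k * (1 + |w.im|⁻¹) ^ s := by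
            rw [mul_inv_cancel₀ hw0.ne']
        _ ≤ 2 * A2 * (2 * (1 + ‖z‖)) ^ k * (1 + |z.im|⁻¹) ^ s := by
            gcongr
            · linarith
            · exact hnorm w hw
        _ = _ := by rw [mul_pow]; ring

/-- Induction on the order of the singularity. Every step uses the bound for two further derivatives
of `φ`, which is why the hypothesis of the induction runs over all test functions. -/
theorem norm_smear_le_polynomial {f : ℂ → ℂ} (hf : DifferentiableOn ℂ f {z : ℂ | z.im ≠ 0})
    {C : ℝ} {k m : ℕ} (hC : 0 ≤ C)
    (hb : ∀ z : ℂ, z.im ≠ 0 → ‖f z‖ ≤ C * (1 + ‖z‖) ^ k * (1 + |z.im|⁻¹) ^ m)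
    (φ : ℝ → ℂ) (hφ : ContDiff ℝ ∞ φ) (hc : HasCompactSupport φ) :
    ∃ A : ℝ, 0 ≤ A ∧ ∀ z : ℂ, z.im ≠ 0 → ‖smear φ f z‖ ≤ A * (1 + ‖z‖) ^ k := by
  have key : ∀ s : ℕ, (∀ φ : ℝ → ℂ, ContDiff ℝ ∞ φ → HasCompactSupport φ →
      ∃ A : ℝ, 0 ≤ A ∧ ∀ z : ℂ, z.im ≠ 0 →
        ‖smear φ f z‖ ≤ A * (1 + ‖z‖) ^ k * (1 + |z.im|⁻¹) ^ s) →
      ∀ φ : ℝ → ℂ, ContDiff ℝ ∞ φ → HasCompactSupport φ →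
        ∃ A : ℝ, 0 ≤ A ∧ ∀ z : ℂ, z.im ≠ 0 → ‖smear φ f z‖ ≤ A * (1 + ‖z‖) ^ k := by
    intro s
    induction s with
    | zero => intro h; simpa using h
    | succ s ih => exact fun h => ih (norm_smear_le_of_succ hf h)
  exact key m (fun φ hφ hc => norm_smear_le hC hb hφ.continuous hc) φ hφ hc

/-- A continuous function that is holomorphic off the real line is entire. -/
theorem differentiable_of_differentiableOn_im_ne_zero {F : ℂ → ℂ} (hc : Continuous F)
    (hd : DifferentiableOn ℂ F {z : ℂ | z.im ≠ 0}) : Differentiable ℂ F := by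
  -- Morera: a rectangle is cut along the real axis. Each half has its interior off the axis, so
  -- Cauchy's theorem applies to it by continuity up to the boundary, and the two contributions
  -- along the axis cancel.
  have hcons : Complex.IsConservativeOn F Set.univ := by
    intro z w _
    rw [← add_eq_zero_iff_eq_neg, Complex.wedgeIntegral_add_wedgeIntegral_eq]
    have h1 := Complex.integral_boundary_rect_eq_zero_of_continuousOn_of_differentiableOn F
      z ⟨w.re, 0⟩ hc.continuousOn (hd.mono ?_)
    · have h2 := Complex.integral_boundary_rect_eq_zero_of_continuousOn_of_differentiableOn F
        ⟨z.re, 0⟩ w hc.continuousOn (hd.mono ?_)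
      · have hi : ∀ x a b : ℝ,
            IntervalIntegrable (fun y : ℝ => F (x + y * Complex.I)) volume a b :=
          fun x a b => (hc.comp (by fun_prop)).intervalIntegrable _ _
        rw [← intervalIntegral.integral_add_adjacent_intervals (hi w.re z.im 0) (hi w.re 0 w.im),
          ← intervalIntegral.integral_add_adjacent_intervals (hi z.re z.im 0) (hi z.re 0 w.im)]
        simp only [smul_eq_mul] at h1 h2 ⊢
        linear_combination h1 + h2
      · rintro u ⟨-, hu⟩ h0
        simp only [Set.mem_preimage, h0, Set.mem_Ioo, min_lt_iff, lt_max_iff] at hu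
        grind
    · rintro u ⟨-, hu⟩ h0
      simp only [Set.mem_preimage, h0, Set.mem_Ioo, min_lt_iff, lt_max_iff] at hu
      grind
  exact differentiableOn_univ.1
    ((hcons.isExactOn_univ hc).differentiableOn isOpen_univ)

/-- If the derivative off the real line has polynomial growth and the function does not jump, then
the function has a limit at every point of the plane. -/
theorem exists_tendsto_of_no_jump {h h' : ℂ → ℂ} {A : ℝ} {k : ℕ}
    (hd : ∀ z : ℂ, z.im ≠ 0 → HasDerivAt h (h' z) z)
    (hb : ∀ z : ℂ, z.im ≠ 0 → ‖h' z‖ ≤ A * (1 + ‖z‖) ^ k) (hA : 0 ≤ A)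
    (hj : ∀ x : ℝ, Tendsto (fun ε : ℝ => h (x + ε * Complex.I) - h (x - ε * Complex.I))
      (𝓝[>] 0) (𝓝 0)) (z : ℂ) :
    ∃ y, Tendsto h (𝓝[{z : ℂ | z.im ≠ 0}] z) (𝓝 y) := by
  by_cases hz : z.im ≠ 0
  · exact ⟨h z, (hd z hz).continuousAt.continuousWithinAt⟩
  push Not at hz
  obtain ⟨x, rfl⟩ : ∃ x : ℝ, z = x := ⟨z.re, Complex.ext rfl (by simpa using hz)⟩
  set L : ℝ := A * (2 + |x|) ^ k with hL
  have hL0 : 0 ≤ L := by positivity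
  have hbL : ∀ u ∈ Metric.ball (x : ℂ) 1, u.im ≠ 0 → ‖h' u‖ ≤ L := by
    intro u hu hu0
    refine (hb u hu0).trans ?_
    rw [mem_ball_iff_norm] at hu
    have : ‖u‖ ≤ ‖(x : ℂ)‖ + ‖u - x‖ := by simpa using norm_add_le (x : ℂ) (u - x)
    rw [Complex.norm_real, Real.norm_eq_abs] at this
    exact mul_le_mul_of_nonneg_left (pow_le_pow_left₀ (by positivity) (by linarith) _) hA
  -- Each open half-disc is convex and the derivative is bounded by `L` there; the sign of `σ`
  -- selects the half.
  have hLip : ∀ σ : ℝ, ∀ u ∈ Metric.ball (x : ℂ) 1, ∀ v ∈ Metric.ball (x : ℂ) 1,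
      0 < σ * u.im → 0 < σ * v.im → ‖h u - h v‖ ≤ L * ‖u - v‖ := by
    intro σ u hu v hv hu0 hv0
    have hconv : Convex ℝ ({w : ℂ | 0 < σ * w.im} ∩ Metric.ball (x : ℂ) 1) := by
      refine Convex.inter ?_ (convex_ball _ _)
      have : {w : ℂ | 0 < σ * w.im} = (fun w : ℂ => (σ • Complex.imLm) w) ⁻¹' Set.Ioi 0 := by
        ext; simp
      rw [this]
      exact (convex_Ioi (0 : ℝ)).linear_preimage (σ • Complex.imLm)
    have hne : ∀ w : ℂ, 0 < σ * w.im → w.im ≠ 0 := fun w hw h0 => by simp [h0] at hw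
    exact hconv.norm_image_sub_le_of_norm_hasDerivWithin_le (f' := h')
      (fun w hw => (hd w (hne w hw.1)).hasDerivWithinAt)
      (fun w hw => hbL w hw.2 (hne w hw.1)) ⟨hv0, hv⟩ ⟨hu0, hu⟩
  -- Points on opposite sides are joined through x + iε and x - iε, and the missing step across the
  -- axis vanishes in the limit by `hj`.
  have hopp : ∀ u ∈ Metric.ball (x : ℂ) 1, ∀ v ∈ Metric.ball (x : ℂ) 1,
      0 < u.im → v.im < 0 → ‖h u - h v‖ ≤ L * ‖u - x‖ + L * ‖v - x‖ := by
    intro u hu v hv hu0 hv0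
    have h1 : Tendsto (fun ε : ℝ => L * ‖u - (x + ε * Complex.I)‖ +
        ‖h (x + ε * Complex.I) - h (x - ε * Complex.I)‖ + L * ‖v - (x - ε * Complex.I)‖)
        (𝓝[>] 0) (𝓝 (L * ‖u - x‖ + ‖(0 : ℂ)‖ + L * ‖v - x‖)) := by
      refine Tendsto.add (Tendsto.add ?_ (hj x).norm) ?_
      · refine tendsto_nhdsWithin_of_tendsto_nhds ?_
        have : Continuous fun ε : ℝ => L * ‖u - (x + ε * Complex.I)‖ := by fun_prop
        simpa using this.tendsto 0
      · refine tendsto_nhdsWithin_of_tendsto_nhds ?_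
        have : Continuous fun ε : ℝ => L * ‖v - (x - ε * Complex.I)‖ := by fun_prop
        simpa using this.tendsto 0
    rw [norm_zero, add_zero] at h1
    refine ge_of_tendsto h1 ?_
    filter_upwards [Ioo_mem_nhdsGT (show (0 : ℝ) < 1 by norm_num)] with ε hε
    have ha := hLip 1 u hu (x + ε * Complex.I)
      (by simp [abs_of_pos hε.1, hε.2]) (by simpa using hu0)
      (by simpa using hε.1)
    have hb' := hLip (-1) v hv (x - ε * Complex.I)
      (by simp [abs_of_pos hε.1, hε.2]) (by simpa using hv0)
      (by simpa using hε.1)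
    calc ‖h u - h v‖ = ‖(h u - h (x + ε * Complex.I)) +
          (h (x + ε * Complex.I) - h (x - ε * Complex.I)) - (h v - h (x - ε * Complex.I))‖ := by
          congr 1; ring
      _ ≤ _ := (norm_sub_le _ _).trans (add_le_add ((norm_add_le _ _).trans
          (add_le_add ha le_rfl)) hb')
  have hall : ∀ u ∈ Metric.ball (x : ℂ) 1, ∀ v ∈ Metric.ball (x : ℂ) 1,
      u.im ≠ 0 → v.im ≠ 0 → ‖h u - h v‖ ≤ L * ‖u - x‖ + L * ‖v - x‖ := by
    intro u hu v hv hu0 hv0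
    have hsame : ‖u - v‖ ≤ ‖u - x‖ + ‖v - x‖ := by
      have : u - v = (u - x) - (v - x) := by ring
      rw [this]
      exact norm_sub_le _ _
    have hsame' : L * ‖u - v‖ ≤ L * ‖u - x‖ + L * ‖v - x‖ := by
      rw [← mul_add]; gcongr
    rcases lt_or_gt_of_ne hu0 with hu1 | hu1 <;> rcases lt_or_gt_of_ne hv0 with hv1 | hv1
    · exact (hLip (-1) u hu v hv (by simpa using hu1) (by simpa using hv1)).trans hsame'
    · rw [norm_sub_rev, add_comm]
      exact hopp v hv u hu hv1 hu1
    · exact hopp u hu v hv hu1 hv1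
    · exact (hLip 1 u hu v hv (by simpa using hu1) (by simpa using hv1)).trans hsame'
  have : (𝓝[{z : ℂ | z.im ≠ 0}] (x : ℂ)).NeBot :=
    mem_closure_iff_nhdsWithin_neBot.1 (dense_im_ne_zero _)
  refine cauchy_map_iff_exists_tendsto.1 ?_
  rw [Metric.cauchy_iff]
  refine ⟨inferInstance, fun ε hε => ?_⟩
  -- Two points within `r` of `x` have values less than 2Lr + 2r ≤ ε apart; the summand 1 covers L =
  -- 0.
  set r : ℝ := min 1 (ε / (2 * (L + 1))) with hr
  have hr0 : 0 < r := by positivity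
  refine ⟨h '' (Metric.ball (x : ℂ) r ∩ {z : ℂ | z.im ≠ 0}),
    image_mem_map (inter_mem (mem_nhdsWithin_of_mem_nhds (Metric.ball_mem_nhds _ hr0))
      self_mem_nhdsWithin), ?_⟩
  rintro _ ⟨u, ⟨hu, hu0⟩, rfl⟩ _ ⟨v, ⟨hv, hv0⟩, rfl⟩
  have hsub := Metric.ball_subset_ball (x := (x : ℂ)) (min_le_left 1 (ε / (2 * (L + 1))))
  have h1 := hall u (hsub hu) v (hsub hv) hu0 hv0
  rw [mem_ball_iff_norm] at hu hv
  have hrε : r * (2 * (L + 1)) ≤ ε := by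
    rw [← le_div_iff₀ (by positivity)]
    exact min_le_right _ _
  rw [dist_eq_norm]
  nlinarith [norm_nonneg (u - x), norm_nonneg (v - x), mul_le_mul_of_nonneg_left hu.le hL0,
    mul_le_mul_of_nonneg_left hv.le hL0]

/-- An entire function of polynomial growth is a polynomial. -/
theorem exists_polynomial_of_norm_le {F : ℂ → ℂ} (hF : Differentiable ℂ F) {A : ℝ} {k : ℕ}
    (hb : ∀ z, ‖F z‖ ≤ A * (1 + ‖z‖) ^ k) :
    ∃ P : ℂ[X], P.degree < ((k + 1 : ℕ) : WithBot ℕ) ∧ ∀ z, F z = P.eval z := by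
  -- Cauchy's estimate on circles of radius R → ∞ kills all Taylor coefficients beyond order `k`.
  have hzero : ∀ n, k < n → iteratedDeriv n F 0 = 0 := by
    intro n hn
    have hlim : Tendsto (fun R : ℝ => n.factorial * (A * (1 + R) ^ k) / R ^ n) atTop (𝓝 0) := by
      have h1 : Tendsto (fun R : ℝ => (1 + R) ^ k / R ^ n) atTop (𝓝 0) := by
        have h2 : Tendsto (fun R : ℝ => (R⁻¹ + 1) ^ k * (R ^ (n - k))⁻¹) atTop
            (𝓝 ((0 + 1) ^ k * 0)) :=
          ((tendsto_inv_atTop_zero.add_const 1).pow k).mul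
            (tendsto_inv_atTop_zero.comp (tendsto_pow_atTop (by omega)))
        rw [mul_zero] at h2
        refine h2.congr' ?_
        filter_upwards [eventually_gt_atTop 0] with R hR
        have h3 : R⁻¹ + 1 = (1 + R) / R := by field_simp
        have h4 : R ^ n = R ^ k * R ^ (n - k) := by rw [← pow_add]; congr 1; omega
        rw [h3, h4, div_pow]
        field_simp
      have := h1.const_mul (n.factorial * A : ℝ)
      rw [mul_zero] at this
      exact this.congr fun R => by ring
    refine norm_le_zero_iff.1 (ge_of_tendsto hlim ?_)
    filter_upwards [eventually_gt_atTop 0] with R hR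
    refine Complex.norm_iteratedDeriv_le_of_forall_mem_sphere_norm_le n hR hF.diffContOnCl ?_
    intro z hz
    have : ‖z‖ = R := by simpa using hz
    rw [← this]
    exact hb z
  refine ⟨∑ n ∈ Finset.range (k + 1), C ((n.factorial : ℂ)⁻¹ * iteratedDeriv n F 0) * X ^ n,
    ?_, fun z => ?_⟩
  · refine (degree_sum_le _ _).trans_lt ((Finset.sup_lt_iff (WithBot.bot_lt_coe _)).2 ?_)
    intro n hn
    refine (degree_C_mul_X_pow_le _ _).trans_lt ?_
    exact_mod_cast Finset.mem_range.1 hn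
  · have h1 := Complex.hasSum_taylorSeries_of_entire hF 0 z
    have h2 := h1.unique (hasSum_sum_of_ne_finset_zero (s := Finset.range (k + 1)) ?_)
    · rw [h2, eval_finsetSum]
      refine Finset.sum_congr rfl fun n _ => ?_
      simp only [sub_zero, smul_eq_mul, eval_mul, eval_C, eval_pow, eval_X]
      ring
    · intro n hn
      rw [hzero n (by simpa using hn)]
      simp

theorem continuousOn_smear {f : ℂ → ℂ} (hf : DifferentiableOn ℂ f {z : ℂ | z.im ≠ 0})
    {φ : ℝ → ℂ} (hφ : ContDiff ℝ ∞ φ) (hc : HasCompactSupport φ) :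
    ContinuousOn (smear φ f) {z : ℂ | z.im ≠ 0} := fun _ hz =>
  (hasDerivAt_smear hf hφ hc hz).continuousAt.continuousWithinAt

/-- The smeared function is a polynomial if the function does not jump. -/
theorem exists_polynomial_smear {f : ℂ → ℂ} (hf : DifferentiableOn ℂ f {z : ℂ | z.im ≠ 0})
    {C : ℝ} {k m : ℕ} (hC : 0 ≤ C)
    (hb : ∀ z : ℂ, z.im ≠ 0 → ‖f z‖ ≤ C * (1 + ‖z‖) ^ k * (1 + |z.im|⁻¹) ^ m)
    (hj : ∀ φ : ℝ → ℂ, ContDiff ℝ ∞ φ → HasCompactSupport φ →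
      Tendsto (fun ε : ℝ => ∫ x : ℝ, φ x * (f (x + ε * Complex.I) - f (x - ε * Complex.I)))
        (𝓝[>] 0) (𝓝 0))
    {φ : ℝ → ℂ} (hφ : ContDiff ℝ ∞ φ) (hc : HasCompactSupport φ) :
    ∃ P : ℂ[X], P.degree < ((k + 1 : ℕ) : WithBot ℕ) ∧
      ∀ z : ℂ, z.im ≠ 0 → smear φ f z = P.eval z := by
  obtain ⟨A0, hA0, hb0⟩ := norm_smear_le_polynomial hf hC hb φ hφ hc
  obtain ⟨A1, hA1, hb1⟩ := norm_smear_le_polynomial hf hC hb (deriv φ)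
    (contDiff_infty_iff_deriv.1 hφ).2 hc.deriv
  have hlim : ∀ z : ℂ, ∃ y, Tendsto (smear φ f) (𝓝[{z : ℂ | z.im ≠ 0}] z) (𝓝 y) := by
    refine exists_tendsto_of_no_jump (fun z hz => hasDerivAt_smear hf hφ hc hz) hb1 hA1 ?_
    intro x
    -- After the substitution u = x - t, the pointwise jump of the smeared function at `x` is the
    -- weak jump of `f` tested against u ↦ φ(x - u).
    have hφx : ContDiff ℝ ∞ fun u : ℝ => φ (x - u) := hφ.comp (contDiff_const.sub contDiff_id)
    have hcx : HasCompactSupport fun u : ℝ => φ (x - u) :=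
      hc.comp_homeomorph (Homeomorph.subLeft x)
    refine (hj _ hφx hcx).congr' ?_
    filter_upwards [self_mem_nhdsWithin] with ε hε
    have hε0 : ε ≠ 0 := ne_of_gt hε
    have hs : ∀ a : ℂ, a.im ≠ 0 → smear φ f (x + a) = ∫ u : ℝ, φ (x - u) * f (u + a) := by
      intro a ha
      rw [smear, ← integral_sub_left_eq_self _ volume x]
      refine integral_congr_ae (Eventually.of_forall fun u => ?_)
      simp only [Complex.ofReal_sub]
      congr 2
      ring
    have hi : ∀ a : ℂ, a.im ≠ 0 → Integrable fun u : ℝ => φ (x - u) * f (u + a) := by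
      intro a ha
      refine Continuous.integrable_of_hasCompactSupport
        (hφx.continuous.mul (hf.continuousOn.comp_continuous (by fun_prop) (by simpa using ha)))
        hcx.mul_right
    have h1 := hs (ε * Complex.I) (by simpa using hε0)
    have h2 := hs (-(ε * Complex.I)) (by simpa using hε0)
    simp only [← sub_eq_add_neg] at h2
    rw [h1, h2, ← integral_sub (hi _ (by simpa using hε0))]
    · simp only [mul_sub]
    · simpa only [← sub_eq_add_neg] using hi (-(ε * Complex.I)) (by simpa using hε0)
  set F := extendFrom {z : ℂ | z.im ≠ 0} (smear φ f) with hFdef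
  have hFc : Continuous F := continuous_extendFrom dense_im_ne_zero hlim
  have hFe : ∀ z : ℂ, z.im ≠ 0 → F z = smear φ f z := fun z hz =>
    extendFrom_extends (continuousOn_smear hf hφ hc) z hz
  have hFd : DifferentiableOn ℂ F {z : ℂ | z.im ≠ 0} := fun z hz =>
    ((hasDerivAt_smear hf hφ hc hz).differentiableAt.congr_of_eventuallyEq
      (by filter_upwards [isOpen_im_ne_zero.mem_nhds hz] with w hw using hFe w hw)
      ).differentiableWithinAt
  obtain ⟨P, hP, hPF⟩ := exists_polynomial_of_norm_le (A := A0) (k := k)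
    (differentiable_of_differentiableOn_im_ne_zero hFc hFd) (by
      intro z
      have hcl : IsClosed {z : ℂ | ‖F z‖ ≤ A0 * (1 + ‖z‖) ^ k} :=
        isClosed_le (by fun_prop) (by fun_prop)
      have hsub : {z : ℂ | z.im ≠ 0} ⊆ {z : ℂ | ‖F z‖ ≤ A0 * (1 + ‖z‖) ^ k} := fun w hw => by
        simpa only [Set.mem_ofPred_eq, hFe w hw] using hb0 w hw
      exact hcl.closure_subset_iff.2 hsub (dense_im_ne_zero z))
  exact ⟨P, hP, fun z hz => (hFe z hz).symm.trans (hPF z)⟩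

/-- A function of slow growth that is holomorphic off the real line and has no jump (in the weak
sense) across the real line is a polynomial. -/
theorem exists_polynomial_of_weak_no_jump {f : ℂ → ℂ}
    (hf : DifferentiableOn ℂ f {z : ℂ | z.im ≠ 0}) {C : ℝ} {k m : ℕ}
    (hb : ∀ z : ℂ, z.im ≠ 0 → ‖f z‖ ≤ C * (1 + ‖z‖) ^ k * (1 + |z.im|⁻¹) ^ m)
    (hj : ∀ φ : ℝ → ℂ, ContDiff ℝ ∞ φ → HasCompactSupport φ →
      Tendsto (fun ε : ℝ => ∫ x : ℝ, φ x * (f (x + ε * Complex.I) - f (x - ε * Complex.I)))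
        (𝓝[>] 0) (𝓝 0)) :
    ∃ P : ℂ[X], ∀ z : ℂ, z.im ≠ 0 → f z = P.eval z := by
  have hC : 0 ≤ C := by
    have h1 := (norm_nonneg _).trans (hb Complex.I (by simp))
    have h2 : (0 : ℝ) < (1 + ‖Complex.I‖) ^ k * (1 + |Complex.I.im|⁻¹) ^ m := by positivity
    rw [mul_assoc] at h1
    exact nonneg_of_mul_nonneg_left h1 h2
  let bump : ℕ → ContDiffBump (0 : ℝ) := fun n =>
    ⟨1 / (n + 1 : ℝ) / 2, 1 / (n + 1 : ℝ), by positivity, half_lt_self (by positivity)⟩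
  let φ : ℕ → ℝ → ℂ := fun n t => ((bump n).normed volume t : ℂ)
  have hφ : ∀ n, ContDiff ℝ ∞ (φ n) := fun n =>
    Complex.ofRealCLM.contDiff.comp (bump n).contDiff_normed
  have hφc : ∀ n, HasCompactSupport (φ n) := fun n =>
    (bump n).hasCompactSupport_normed.comp_left (g := fun t : ℝ => (t : ℂ)) (by simp)
  choose P hPd hP using fun n => exists_polynomial_smear hf hC hb hj (hφ n) (hφc n)
  have hlim : ∀ z : ℂ, z.im ≠ 0 → Tendsto (fun n => smear (φ n) f z) atTop (𝓝 (f z)) := by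
    intro z hz
    have h1 := ContDiffBump.convolution_tendsto_right_of_continuous (μ := (volume : Measure ℝ))
      (φ := bump) (l := atTop) (g := fun t : ℝ => f (z + t)) tendsto_one_div_add_atTop_nhds_zero_nat
      (hf.continuousOn.comp_continuous (by fun_prop) (by simpa using hz)) 0
    simp only [Complex.ofReal_zero, add_zero] at h1
    refine h1.congr fun n => ?_
    rw [smear, MeasureTheory.convolution]
    refine integral_congr_ae (Eventually.of_forall fun t => ?_)
    simp [φ, sub_eq_add_neg]
  -- These k + 1 distinct points off the real axis determine a polynomial of degree at most `k`. The
  -- interpolation formula holds for every smeared function and passes to the pointwise limit.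
  let node : ℕ → ℂ := fun j => j + Complex.I
  have hnode : Set.InjOn node (Finset.range (k + 1)) := by
    intro a _ b _ hab
    simpa [node] using hab
  have hnode0 : ∀ j, (node j).im ≠ 0 := fun j => by simp [node]
  refine ⟨Lagrange.interpolate (Finset.range (k + 1)) node fun j => f (node j), fun z hz => ?_⟩
  have h1 : ∀ n, smear (φ n) f z =
      ∑ j ∈ Finset.range (k + 1), smear (φ n) f (node j) *
        (Lagrange.basis (Finset.range (k + 1)) node j).eval z := by
    intro n
    have h2 := Lagrange.eq_interpolate_of_eval_eq (r := fun j => smear (φ n) f (node j)) hnode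
      (f := P n) (by simpa using hPd n) (fun j _ => (hP n _ (hnode0 j)).symm)
    rw [hP n z hz, h2, Lagrange.interpolate_apply, eval_finsetSum]
    simp
  have h3 : Tendsto (fun n => ∑ j ∈ Finset.range (k + 1), smear (φ n) f (node j) *
        (Lagrange.basis (Finset.range (k + 1)) node j).eval z) atTop
      (𝓝 (∑ j ∈ Finset.range (k + 1), f (node j) *
        (Lagrange.basis (Finset.range (k + 1)) node j).eval z)) :=
    tendsto_finsetSum _ fun j _ => (hlim _ (hnode0 j)).mul_const _
  rw [tendsto_nhds_unique ((hlim z hz).congr h1) h3, Lagrange.interpolate_apply, eval_finsetSum]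
  simp

/-! ### Cauchy transforms -/

/-- The Cauchy transform `∫ ρ(t) dt / (z - t)`. -/
def cauchyTransform (ρ : ℝ → ℂ) (z : ℂ) : ℂ := ∫ t : ℝ, ρ t / (z - t)

/-- The point `z` has positive distance from the set where `ρ` does not vanish. -/
def IsSeparated (ρ : ℝ → ℂ) (z : ℂ) : Prop := ∃ δ > 0, ∀ t : ℝ, ρ t ≠ 0 → δ ≤ ‖z - t‖

/-- All moments of `ρ` are finite. -/
def HasMoments (ρ : ℝ → ℂ) : Prop := ∀ n : ℕ, Integrable fun t : ℝ => (t : ℂ) ^ n * ρ t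

theorem abs_im_le_norm_sub_ofReal (z : ℂ) (t : ℝ) : |z.im| ≤ ‖z - t‖ := by
  simpa using Complex.abs_im_le_norm (z - t)

theorem isSeparated_of_im_ne_zero (ρ : ℝ → ℂ) {z : ℂ} (hz : z.im ≠ 0) : IsSeparated ρ z :=
  ⟨|z.im|, abs_pos.2 hz, fun t _ => abs_im_le_norm_sub_ofReal z t⟩

theorem IsSeparated.mul_left {ρ : ℝ → ℂ} {z : ℂ} (h : IsSeparated ρ z) (g : ℝ → ℂ) :
    IsSeparated (fun t => g t * ρ t) z := by
  obtain ⟨δ, hδ, h⟩ := h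
  exact ⟨δ, hδ, fun t ht => h t (right_ne_zero_of_mul ht)⟩

theorem isSeparated_of_notMem {ρ : ℝ → ℂ} {K : Set ℝ} (hK : IsClosed K)
    (hρ : ∀ t, ρ t ≠ 0 → t ∈ K) {z : ℂ} (hz : z ∉ (fun t : ℝ => (t : ℂ)) '' K) :
    IsSeparated ρ z := by
  have hcl : IsClosed ((fun t : ℝ => (t : ℂ)) '' K) :=
    Complex.isometry_ofReal.isClosedEmbedding.isClosedMap K hK
  obtain ⟨δ, hδ, hb⟩ := Metric.isOpen_iff.1 hcl.isOpen_compl z hz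
  refine ⟨δ, hδ, fun t ht => ?_⟩
  by_contra! hlt
  refine hb (show (t : ℂ) ∈ Metric.ball z δ from ?_) ⟨t, hρ t ht, rfl⟩
  rwa [Metric.mem_ball, dist_comm, dist_eq_norm]

theorem IsSeparated.sub_ne_zero {ρ : ℝ → ℂ} {z : ℂ} (h : IsSeparated ρ z) {t : ℝ}
    (ht : ρ t ≠ 0) : z - t ≠ 0 := by
  obtain ⟨δ, hδ, h⟩ := h
  exact norm_pos_iff.1 (hδ.trans_le (h t ht))

theorem HasMoments.integrable {ρ : ℝ → ℂ} (h : HasMoments ρ) : Integrable ρ := by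
  simpa using h 0

theorem HasMoments.pow_mul {ρ : ℝ → ℂ} (h : HasMoments ρ) (m : ℕ) :
    HasMoments fun t => (t : ℂ) ^ m * ρ t := fun n => by
  simpa only [← mul_assoc, ← pow_add] using h (n + m)

theorem HasMoments.add {ρ σ : ℝ → ℂ} (hρ : HasMoments ρ) (hσ : HasMoments σ) :
    HasMoments fun t => ρ t + σ t := fun n => by
  simpa only [mul_add] using! (hρ n).add (hσ n)

theorem HasMoments.const_mul {ρ : ℝ → ℂ} (hρ : HasMoments ρ) (a : ℂ) :
    HasMoments fun t => a * ρ t := fun n => by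
  simpa only [mul_left_comm] using (hρ n).const_mul a

theorem HasMoments.polynomial_mul {ρ : ℝ → ℂ} (h : HasMoments ρ) (f : ℂ[X]) :
    HasMoments fun t : ℝ => f.eval (t : ℂ) * ρ t := by
  induction f using Polynomial.induction_on' with
  | add f g hf hg => simpa only [eval_add, add_mul] using hf.add hg
  | monomial n a => simpa only [eval_monomial, mul_assoc] using (h.pow_mul n).const_mul a

theorem integrable_div_sub {ρ : ℝ → ℂ} (hρ : Integrable ρ) {z : ℂ} (hz : IsSeparated ρ z) :
    Integrable fun t : ℝ => ρ t / (z - t) := by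
  obtain ⟨δ, hδ, hz⟩ := hz
  refine (hρ.norm.mul_const δ⁻¹).mono' ?_ (Eventually.of_forall fun t => ?_)
  · exact hρ.aestronglyMeasurable.mul
      (by fun_prop : Measurable fun t : ℝ => (z - t)⁻¹).aestronglyMeasurable
  · by_cases ht : ρ t = 0
    · simp [ht]
    · rw [norm_div, div_eq_mul_inv]
      gcongr
      exact hz t ht

theorem norm_cauchyTransform_le {ρ : ℝ → ℂ} (hρ : Integrable ρ) {z : ℂ} (hz : z.im ≠ 0) :
    ‖cauchyTransform ρ z‖ ≤ (∫ t, ‖ρ t‖) * |z.im|⁻¹ := by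
  rw [← integral_mul_const]
  refine norm_integral_le_of_norm_le (hρ.norm.mul_const _) (Eventually.of_forall fun t => ?_)
  rw [norm_div, div_eq_mul_inv]
  have := abs_pos.2 hz
  gcongr
  exact abs_im_le_norm_sub_ofReal z t

theorem differentiableAt_cauchyTransform {ρ : ℝ → ℂ} (hρ : Integrable ρ) {z : ℂ}
    (hz : IsSeparated ρ z) : DifferentiableAt ℂ (cauchyTransform ρ) z := by
  have hi := integrable_div_sub hρ hz
  obtain ⟨δ, hδ, hz⟩ := hz
  have hball : ∀ w ∈ Metric.ball z (δ / 2), ∀ t : ℝ, ρ t ≠ 0 → δ / 2 ≤ ‖w - t‖ := by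
    intro w hw t ht
    have h1 := hz t ht
    rw [Metric.mem_ball, dist_comm, dist_eq_norm] at hw
    have h2 : ‖z - t‖ ≤ ‖z - w‖ + ‖w - t‖ := by simpa using norm_add_le (z - w) (w - t)
    linarith
  have hm : ∀ w : ℂ, AEStronglyMeasurable (fun t : ℝ => ρ t / (w - t)) volume := fun w =>
    hρ.aestronglyMeasurable.mul
      (by fun_prop : Measurable fun t : ℝ => (w - t)⁻¹).aestronglyMeasurable
  have key := hasDerivAt_integral_of_dominated_loc_of_deriv_le (μ := volume)
    (F := fun (w : ℂ) (t : ℝ) => ρ t / (w - t)) (F' := fun w t => ρ t * (-1 / (w - t) ^ 2))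
    (bound := fun t => ‖ρ t‖ * ((δ / 2) ^ 2)⁻¹) (x₀ := z) (s := Metric.ball z (δ / 2))
    (Metric.ball_mem_nhds z (by positivity)) (Eventually.of_forall hm) hi
    (hρ.aestronglyMeasurable.mul
      (by fun_prop : Measurable fun t : ℝ => -1 / (z - t) ^ 2).aestronglyMeasurable) ?_
    (hρ.norm.mul_const _) ?_
  · exact key.2.differentiableAt
  · refine Eventually.of_forall fun t w hw => ?_
    by_cases ht : ρ t = 0
    · simp [ht]
    · rw [norm_mul, norm_div, norm_neg, norm_one, one_div, norm_pow]
      gcongr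
      exact hball w hw t ht
  · refine Eventually.of_forall fun t w hw => ?_
    by_cases ht : ρ t = 0
    · simpa [ht] using! hasDerivAt_const w (0 : ℂ)
    · have h0 : w - t ≠ 0 := norm_pos_iff.1 ((half_pos hδ).trans_le (hball w hw t ht))
      have h1 := (((hasDerivAt_id w).sub_const (t : ℂ)).inv h0).const_mul (ρ t)
      simpa [div_eq_mul_inv] using! h1

/-- z / (z - t) = 1 + t / (z - t). -/
theorem mul_cauchyTransform {ρ : ℝ → ℂ} (hρ : Integrable ρ)
    (hρ1 : Integrable fun t : ℝ => (t : ℂ) * ρ t) {z : ℂ} (hz : IsSeparated ρ z) :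
    z * cauchyTransform ρ z = (∫ t, ρ t) + cauchyTransform (fun t => (t : ℂ) * ρ t) z := by
  rw [cauchyTransform, cauchyTransform, ← integral_const_mul,
    ← integral_add hρ (integrable_div_sub hρ1 (hz.mul_left _))]
  refine integral_congr_ae (Eventually.of_forall fun t => ?_)
  by_cases ht : ρ t = 0
  · simp [ht]
  · have := hz.sub_ne_zero ht
    field_simp
    ring

theorem cauchyTransform_add {ρ σ : ℝ → ℂ} (hρ : Integrable ρ) (hσ : Integrable σ) {z : ℂ}
    (hz : IsSeparated ρ z) (hz' : IsSeparated σ z) :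
    cauchyTransform (fun t => ρ t + σ t) z = cauchyTransform ρ z + cauchyTransform σ z := by
  rw [cauchyTransform, cauchyTransform, cauchyTransform,
    ← integral_add (integrable_div_sub hρ hz) (integrable_div_sub hσ hz')]
  simp only [add_div]

theorem cauchyTransform_const_mul (ρ : ℝ → ℂ) (a z : ℂ) :
    cauchyTransform (fun t => a * ρ t) z = a * cauchyTransform ρ z := by
  rw [cauchyTransform, cauchyTransform, ← integral_const_mul]
  simp only [mul_div_assoc]

theorem cauchyTransform_sum {ι : Type*} (s : Finset ι) {ρ : ι → ℝ → ℂ}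
    (hρ : ∀ i ∈ s, Integrable (ρ i)) {z : ℂ} (hz : ∀ i ∈ s, IsSeparated (ρ i) z) :
    cauchyTransform (fun t => ∑ i ∈ s, ρ i t) z = ∑ i ∈ s, cauchyTransform (ρ i) z := by
  simp only [cauchyTransform]
  rw [← integral_finsetSum s fun i hi => integrable_div_sub (hρ i hi) (hz i hi)]
  simp only [Finset.sum_div]

/-- Multiplication by a polynomial commutes with the Cauchy transform up to a polynomial. -/
theorem exists_polynomial_mul_cauchyTransform {ρ : ℝ → ℂ} (hρ : HasMoments ρ) (f : ℂ[X]) :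
    ∃ D : ℂ[X], ∀ z, IsSeparated ρ z → f.eval z * cauchyTransform ρ z =
      D.eval z + cauchyTransform (fun t : ℝ => f.eval (t : ℂ) * ρ t) z := by
  induction f using Polynomial.induction_on' with
  | add f g hf hg =>
    obtain ⟨D, hD⟩ := hf
    obtain ⟨E, hE⟩ := hg
    refine ⟨D + E, fun z hz => ?_⟩
    simp only [eval_add, add_mul]
    rw [hD z hz, hE z hz, cauchyTransform_add (hρ.polynomial_mul f).integrable
      (hρ.polynomial_mul g).integrable (hz.mul_left _) (hz.mul_left _)]
    ring
  | monomial n a =>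
    have key : ∃ D : ℂ[X], ∀ z, IsSeparated ρ z → z ^ n * cauchyTransform ρ z =
        D.eval z + cauchyTransform (fun t : ℝ => (t : ℂ) ^ n * ρ t) z := by
      induction n with
      | zero => exact ⟨0, fun z _ => by simp⟩
      | succ n ih =>
        obtain ⟨D, hD⟩ := ih
        refine ⟨X * D + C (∫ t : ℝ, (t : ℂ) ^ n * ρ t), fun z hz => ?_⟩
        have h1 := mul_cauchyTransform (hρ n)
          (by simpa only [← mul_assoc, ← pow_succ'] using hρ (n + 1)) (hz.mul_left _)
        simp only [← mul_assoc, ← pow_succ'] at h1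
        rw [pow_succ', mul_assoc, hD z hz, mul_add, h1]
        simp only [eval_add, eval_mul, eval_X, eval_C]
        ring
    obtain ⟨D, hD⟩ := key
    refine ⟨C a * D, fun z hz => ?_⟩
    simp only [eval_monomial, mul_assoc]
    rw [hD z hz, cauchyTransform_const_mul]
    simp only [eval_mul, eval_C]
    ring

/-- A linear factor whose root is the argument comes out of the Cauchy transform. -/
theorem cauchyTransform_sub_mul {ρ : ℝ → ℂ} (hρ : HasMoments ρ) {z : ℂ} (hz : IsSeparated ρ z)
    (w : ℂ) : cauchyTransform (fun t => ((t : ℂ) - w) * ρ t) z =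
      (z - w) * cauchyTransform ρ z - ∫ t, ρ t := by
  have h1 := mul_cauchyTransform hρ.integrable (by simpa using hρ 1) hz
  have h2 : cauchyTransform (fun t => ((t : ℂ) - w) * ρ t) z =
      cauchyTransform (fun t => (t : ℂ) * ρ t + (-w) * ρ t) z := by
    congr 1
    ext t
    ring
  rw [h2, cauchyTransform_add (by simpa using hρ 1) (hρ.integrable.const_mul _) (hz.mul_left _)
    (hz.mul_left _), cauchyTransform_const_mul]
  linear_combination -h1

/-- The jump of a Cauchy transform, in the weak sense. -/
theorem tendsto_integral_cauchyTransform_jump {ρ : ℝ → ℂ} (hρ : Integrable ρ) {φ : ℝ → ℂ}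
    (hφ : Continuous φ) (hc : HasCompactSupport φ) :
    Tendsto (fun ε : ℝ => ∫ x : ℝ, φ x * (cauchyTransform ρ (x + ε * Complex.I)
      - cauchyTransform ρ (x - ε * Complex.I))) (𝓝[>] 0)
      (𝓝 (-2 * (Real.pi : ℂ) * Complex.I * ∫ x, φ x * ρ x)) := by
  obtain ⟨M, hM⟩ := hc.exists_bound_of_continuous hφ
  have hM0 : 0 ≤ M := (norm_nonneg _).trans (hM 0)
  have hg : Integrable fun s : ℝ => (1 + s ^ 2)⁻¹ := integrable_inv_one_add_sq
  have hgm : Continuous fun s : ℝ => ((1 + s ^ 2)⁻¹ : ℝ) :=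
    Continuous.inv₀ (by fun_prop) fun s => by positivity
  -- The substitution x = t + εs turns the Poisson average of `φ` about `t` into an integral against
  -- the fixed kernel 1 / (1 + s²) of total mass π.
  set J : ℝ → ℝ → ℂ := fun ε t => ∫ s : ℝ, φ (t + ε * s) * ((1 + s ^ 2)⁻¹ : ℝ) with hJ
  have hJb : ∀ ε t s : ℝ, ‖φ (t + ε * s) * (((1 + s ^ 2)⁻¹ : ℝ) : ℂ)‖ ≤ M * (1 + s ^ 2)⁻¹ := by
    intro ε t s
    rw [norm_mul, Complex.norm_real, Real.norm_of_nonneg (by positivity)]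
    exact mul_le_mul_of_nonneg_right (hM _) (by positivity)
  have hJm : ∀ ε t : ℝ, AEStronglyMeasurable
      (fun s : ℝ => φ (t + ε * s) * (((1 + s ^ 2)⁻¹ : ℝ) : ℂ)) volume := fun ε t =>
    ((hφ.comp (by fun_prop)).mul
      (Complex.continuous_ofReal.comp hgm)).aestronglyMeasurable
  have hJc : ∀ ε, Continuous (J ε) := fun ε =>
    continuous_of_dominated (hJm ε) (fun t => Eventually.of_forall (hJb ε t)) (hg.const_mul M)
      (Eventually.of_forall fun s => (hφ.comp (by fun_prop)).mul continuous_const)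
  have hJn : ∀ ε t, ‖J ε t‖ ≤ M * Real.pi := by
    intro ε t
    refine (norm_integral_le_of_norm_le (hg.const_mul M)
      (Eventually.of_forall (hJb ε t))).trans_eq ?_
    rw [integral_const_mul, integral_univ_inv_one_add_sq]
  have hJ0 : ∀ t, Tendsto (fun ε => J ε t) (𝓝[>] 0) (𝓝 (φ t * Real.pi)) := by
    intro t
    have h1 : φ t * (Real.pi : ℂ) = ∫ s : ℝ, φ t * (((1 + s ^ 2)⁻¹ : ℝ) : ℂ) := by
      rw [integral_const_mul, integral_complex_ofReal, integral_univ_inv_one_add_sq]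
    rw [h1]
    refine tendsto_integral_filter_of_dominated_convergence (fun s => M * (1 + s ^ 2)⁻¹)
      (Eventually.of_forall fun ε => hJm ε t)
      (Eventually.of_forall fun ε => Eventually.of_forall (hJb ε t)) (hg.const_mul M)
      (Eventually.of_forall fun s => ?_)
    refine Tendsto.mul_const _ (tendsto_nhdsWithin_of_tendsto_nhds ?_)
    have : Continuous fun ε : ℝ => φ (t + ε * s) := hφ.comp (by fun_prop)
    simpa using this.tendsto 0
  have hlim : Tendsto (fun ε => ∫ t, ρ t * J ε t) (𝓝[>] 0) (𝓝 (∫ t, ρ t * (φ t * Real.pi))) := by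
    refine tendsto_integral_filter_of_dominated_convergence (fun t => ‖ρ t‖ * (M * Real.pi))
      (Eventually.of_forall fun ε =>
        hρ.aestronglyMeasurable.mul (hJc ε).aestronglyMeasurable)
      (Eventually.of_forall fun ε => Eventually.of_forall fun t => ?_) (hρ.norm.mul_const _)
      (Eventually.of_forall fun t => (hJ0 t).const_mul _)
    rw [norm_mul]
    exact mul_le_mul_of_nonneg_left (hJn ε t) (norm_nonneg _)
  have hfin := hlim.const_mul (-2 * Complex.I)
  have hval : -2 * Complex.I * ∫ t, ρ t * (φ t * Real.pi) =
      -2 * (Real.pi : ℂ) * Complex.I * ∫ x, φ x * ρ x := by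
    have : ∀ t, ρ t * (φ t * Real.pi) = Real.pi * (φ t * ρ t) := fun t => by ring
    simp only [this]
    rw [integral_const_mul]
    ring
  rw [hval] at hfin
  refine hfin.congr' ?_
  filter_upwards [self_mem_nhdsWithin] with ε hε
  have hε0 : 0 < ε := hε
  have hsum : ∀ x t : ℝ, (0 : ℝ) < (x - t) ^ 2 + ε ^ 2 := fun x t => by positivity
  have hp : ∀ x : ℝ, ((x : ℂ) + ε * Complex.I).im ≠ 0 := fun x => by simpa using hε0.ne'
  have hn : ∀ x : ℝ, ((x : ℂ) - ε * Complex.I).im ≠ 0 := fun x => by simpa using hε0.ne'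
  -- The difference of the two Cauchy kernels at x + iε and x - iε.
  set k : ℝ → ℝ → ℂ := fun x t => -2 * Complex.I * ((ε / ((x - t) ^ 2 + ε ^ 2) : ℝ) : ℂ) with hk
  have hkc : Continuous fun P : ℝ × ℝ => k P.1 P.2 := by
    refine continuous_const.mul (Complex.continuous_ofReal.comp ?_)
    exact Continuous.div (by fun_prop) (by fun_prop) fun P => (hsum _ _).ne'
  have hkb : ∀ x t, ‖k x t‖ ≤ 2 * ε⁻¹ := by
    intro x t
    have h1 : ε / ((x - t) ^ 2 + ε ^ 2) ≤ ε⁻¹ := by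
      rw [div_le_iff₀ (hsum x t), inv_mul_eq_div, le_div_iff₀ hε0]
      nlinarith [sq_nonneg (x - t)]
    simp only [hk]
    rw [norm_mul, Complex.norm_real, Real.norm_of_nonneg (div_nonneg hε0.le (hsum x t).le)]
    simpa using h1
  have hdiff : ∀ x : ℝ, cauchyTransform ρ (x + ε * Complex.I)
      - cauchyTransform ρ (x - ε * Complex.I) = ∫ t, ρ t * k x t := by
    intro x
    rw [cauchyTransform, cauchyTransform,
      ← integral_sub (integrable_div_sub hρ (isSeparated_of_im_ne_zero ρ (hp x)))
      (integrable_div_sub hρ (isSeparated_of_im_ne_zero ρ (hn x)))]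
    refine integral_congr_ae (Eventually.of_forall fun t => ?_)
    have h1 : (x : ℂ) + ε * Complex.I - t ≠ 0 := fun h => by
      have := congrArg Complex.im h
      simp [hε0.ne'] at this
    have h2 : (x : ℂ) - ε * Complex.I - t ≠ 0 := fun h => by
      have := congrArg Complex.im h
      simp [hε0.ne'] at this
    have h3 : ((x : ℂ) - t) ^ 2 + (ε : ℂ) ^ 2 ≠ 0 := by exact_mod_cast (hsum x t).ne'
    simp only [hk]
    push_cast
    field_simp
    linear_combination -(2 * ρ t * ε ^ 3 * Complex.I) * Complex.I_sq
  simp only [hdiff]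
  have hφi : Integrable φ := hφ.integrable_of_hasCompactSupport hc
  have hprod : Integrable (fun P : ℝ × ℝ => φ P.1 * (ρ P.2 * k P.1 P.2))
      (volume.prod volume) := by
    have h1 : Integrable (fun P : ℝ × ℝ => φ P.1 * ρ P.2) (volume.prod volume) := hφi.mul_prod hρ
    have h2 := h1.mul_bdd (c := 2 * ε⁻¹) hkc.aestronglyMeasurable
      (Eventually.of_forall fun P => hkb P.1 P.2)
    simpa only [mul_assoc] using h2
  have hswap := integral_integral_swap (f := fun x t => φ x * (ρ t * k x t)) hprod
  simp only [integral_const_mul] at hswap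
  rw [hswap, ← integral_const_mul]
  refine integral_congr_ae (Eventually.of_forall fun t => ?_)
  have h1 : ∀ x : ℝ, φ x * (ρ t * k x t) = ρ t * (φ x * k x t) := fun x => by ring
  simp only [h1, integral_const_mul, hJ]
  rw [mul_left_comm]
  congr 1
  have h2 := Measure.integral_comp_mul_left (fun u : ℝ => φ (t + u) * k (t + u) t) ε
  rw [integral_add_left_eq_self (fun u : ℝ => φ u * k u t) t] at h2
  rw [← integral_const_mul]
  have h3 : (∫ x, φ x * k x t) = ε • ∫ s : ℝ, φ (t + ε * s) * k (t + ε * s) t := by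
    rw [h2, abs_of_pos (inv_pos.2 hε0), smul_smul, mul_inv_cancel₀ hε0.ne', one_smul]
  rw [h3, ← integral_smul]
  refine integral_congr_ae (Eventually.of_forall fun s => ?_)
  have h4 : ε / ((t + ε * s - t) ^ 2 + ε ^ 2) = ε⁻¹ * (1 + s ^ 2)⁻¹ := by
    have : 1 + s ^ 2 ≠ 0 := by positivity
    have : (t + ε * s - t) ^ 2 + ε ^ 2 ≠ 0 := (hsum _ _).ne'
    field_simp
    ring
  simp only [hk, h4, Complex.real_smul]
  push_cast
  have : (ε : ℂ) ≠ 0 := by exact_mod_cast hε0.ne'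
  field_simp

/-! ### Behaviour along the imaginary axis -/

theorem tendsto_cauchyTransform_ray {ρ : ℝ → ℂ} (hρ : Integrable ρ) :
    Tendsto (fun s : ℝ => cauchyTransform ρ (s * Complex.I)) atTop (𝓝 0) := by
  have h1 : Tendsto (fun s : ℝ => (∫ t, ‖ρ t‖) * s⁻¹) atTop (𝓝 0) := by
    simpa using tendsto_inv_atTop_zero.const_mul (∫ t, ‖ρ t‖)
  refine squeeze_zero_norm' ?_ h1
  filter_upwards [eventually_gt_atTop 0] with s hs
  simpa [abs_of_pos hs] using norm_cauchyTransform_le hρ (z := s * Complex.I) (by simp [hs.ne'])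

theorem tendsto_norm_ray : Tendsto (fun s : ℝ => ‖(s : ℂ) * Complex.I‖) atTop atTop := by
  simpa using! tendsto_abs_atTop_atTop

/-- A polynomial with a limit along the imaginary axis is constant. -/
theorem eq_C_of_tendsto_ray {P : ℂ[X]} {L : ℂ}
    (h : Tendsto (fun s : ℝ => P.eval (s * Complex.I)) atTop (𝓝 L)) : P = C L := by
  rcases lt_or_ge 0 P.degree with hd | hd
  · exact absurd h.norm
      (not_tendsto_nhds_of_tendsto_atTop (P.tendsto_norm_atTop hd tendsto_norm_ray) _)
  · rw [eq_C_of_degree_le_zero hd] at h ⊢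
    simp only [eval_C] at h
    rw [tendsto_nhds_unique tendsto_const_nhds h]

theorem tendsto_eval_div_pow_ray {P : ℂ[X]} {n : ℕ} (h : P.degree < n) :
    Tendsto (fun s : ℝ => P.eval (s * Complex.I) / (s * Complex.I) ^ n) atTop (𝓝 0) := by
  by_cases hP : P = 0
  · simp [hP]
  have hz : Tendsto (fun s : ℝ => ((s : ℂ) * Complex.I)⁻¹) atTop (𝓝 0) :=
    tendsto_inv₀_cobounded.comp (tendsto_norm_atTop_iff_cobounded.1 tendsto_norm_ray)
  have h1 : Tendsto (fun s : ℝ => ∑ i ∈ Finset.range n,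
      P.coeff i * (((s : ℂ) * Complex.I)⁻¹) ^ (n - i)) atTop
      (𝓝 (∑ i ∈ Finset.range n, P.coeff i * 0 ^ (n - i))) :=
    tendsto_finsetSum _ fun i _ => (hz.pow _).const_mul _
  have h2 : (∑ i ∈ Finset.range n, P.coeff i * (0 : ℂ) ^ (n - i)) = 0 :=
    Finset.sum_eq_zero fun i hi => by
      rw [zero_pow (by have := Finset.mem_range.1 hi; omega), mul_zero]
  rw [h2] at h1
  refine h1.congr' ?_
  filter_upwards [eventually_gt_atTop 0] with s hs
  have hs0 : (s : ℂ) * Complex.I ≠ 0 := by simp [hs.ne']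
  rw [eval_eq_sum_range' (n := n) ((natDegree_lt_iff_degree_lt hP).2 h), Finset.sum_div]
  refine Finset.sum_congr rfl fun i hi => ?_
  have : ((s : ℂ) * Complex.I) ^ n =
      ((s : ℂ) * Complex.I) ^ i * ((s : ℂ) * Complex.I) ^ (n - i) := by
    rw [← pow_add]; congr 1; have := Finset.mem_range.1 hi; omega
  rw [this, inv_pow]
  field_simp

/-- The remainder of division by Xⁿ is o(zⁿ) on the ray, so the quotient has the limit `L` there and
is constant. -/
theorem degree_lt_succ_of_tendsto_ray {P : ℂ[X]} {n : ℕ} {L : ℂ}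
    (h : Tendsto (fun s : ℝ => P.eval (s * Complex.I) / (s * Complex.I) ^ n) atTop (𝓝 L)) :
    P.degree < ((n + 1 : ℕ) : WithBot ℕ) := by
  have hmod := modByMonic_add_div P (X ^ n : ℂ[X])
  have hr : (P %ₘ X ^ n).degree < n := by
    simpa using degree_modByMonic_lt P (monic_X_pow (R := ℂ) n)
  have h1 : Tendsto (fun s : ℝ => (P /ₘ X ^ n).eval (s * Complex.I)) atTop (𝓝 L) := by
    have := h.sub (tendsto_eval_div_pow_ray hr)
    rw [sub_zero] at this
    refine this.congr' ?_
    filter_upwards [eventually_gt_atTop 0] with s hs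
    have hs0 : (s : ℂ) * Complex.I ≠ 0 := by simp [hs.ne']
    have h2 := congrArg (eval ((s : ℂ) * Complex.I)) hmod
    simp only [eval_add, eval_mul, eval_pow, eval_X] at h2
    rw [← h2]
    field_simp
    ring
  rw [eq_C_of_tendsto_ray h1] at hmod
  rw [← hmod, Nat.cast_succ]
  refine (degree_add_le _ _).trans_lt (max_lt (hr.trans ?_) ?_)
  · exact_mod_cast Nat.lt_succ_self n
  · rw [mul_comm]
    refine (degree_C_mul_X_pow_le _ _).trans_lt ?_
    exact_mod_cast Nat.lt_succ_self n

/-! ### Moments -/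

theorem IsDensityPair.symm {α β : ℝ → ℝ} (h : IsDensityPair α β) : IsDensityPair β α where
  nonneg_left := h.nonneg_right
  nonneg_right := h.nonneg_left
  supp_left := h.supp_right
  supp_right := h.supp_left
  integrable_left := h.integrable_right
  integrable_right := h.integrable_left
  bimoments i j := by
    refine (h.bimoments j i).swap.congr (Eventually.of_forall fun P => ?_)
    simp only [Function.comp, Prod.fst_swap, Prod.snd_swap]
    rw [add_comm P.2 P.1]
    ring

/-- Almost every section of a bimoment is integrable, so some y with β(y) ≠ 0 has both sections
needed. Then xⁿ = (xⁿ⁺¹ + y xⁿ) / (x + y) recovers the moment. -/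
theorem IsDensityPair.hasMoments {α β : ℝ → ℝ} (h : IsDensityPair α β)
    (hβ : ¬ β =ᵐ[volume] 0) : HasMoments fun t => (α t : ℂ) := by
  intro n
  have h1 := (h.bimoments n 0).prod_left_ae
  have h2 := (h.bimoments (n + 1) 0).prod_left_ae
  obtain ⟨y, hy, hi1, hi2⟩ : ∃ y : ℝ, β y ≠ 0 ∧
      Integrable (fun x : ℝ => x ^ n * y ^ 0 / (x + y) * (α x * β y)) ∧
      Integrable (fun x : ℝ => x ^ (n + 1) * y ^ 0 / (x + y) * (α x * β y)) := by
    by_contra! hcon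
    refine hβ ?_
    filter_upwards [h1, h2] with y hy1 hy2
    by_contra hy
    exact hcon y hy hy1 hy2
  have hy0 : 0 ≤ y := by
    by_contra! hneg
    exact hy (h.supp_right y hneg)
  have h3 : Integrable fun x : ℝ => x ^ n * α x := by
    refine ((hi2.add (hi1.const_mul y)).mul_const (β y)⁻¹).congr ?_
    filter_upwards [Measure.ae_ne volume (-y)] with x hx
    have hxy : x + y ≠ 0 := fun h0 => hx (by linarith)
    simp only [Pi.add_apply]
    field_simp
    ring
  simpa using h3.ofReal (𝕜 := ℂ)

/-- If one density vanished almost everywhere, the pairing of p₀ with q₀ would be 0 instead of 1. -/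
theorem IsCauchyBOP.not_ae_zero {α β : ℝ → ℝ} {p q : ℕ → ℝ[X]} (h : IsCauchyBOP α β p q) :
    ¬ α =ᵐ[volume] 0 ∧ ¬ β =ᵐ[volume] 0 := by
  have h1 := h.biorthonormal 0 0
  rw [if_pos rfl] at h1
  constructor
  · intro h0
    refine one_ne_zero (h1.symm.trans (integral_eq_zero_of_ae ?_))
    filter_upwards [ae_restrict_of_ae h0] with x hx
    simp [hx]
  · intro h0
    refine one_ne_zero (h1.symm.trans (integral_eq_zero_of_ae (Eventually.of_forall fun x => ?_)))
    refine integral_eq_zero_of_ae ?_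
    filter_upwards [ae_restrict_of_ae h0] with y hy
    simp [hy]

theorem hasMoments_reflected {β : ℝ → ℝ} (h : HasMoments fun t => (β t : ℂ)) :
    HasMoments fun t => (reflected β t : ℂ) := by
  intro n
  refine ((h n).comp_neg.const_mul ((-1) ^ n)).congr (Eventually.of_forall fun t => ?_)
  simp only [reflected, Complex.ofReal_neg]
  rw [neg_pow (t : ℂ), ← mul_assoc, ← mul_assoc, ← mul_pow]
  simp

/-- All bimoments, in terms of the reflected density. -/
theorem IsDensityPair.integrable_kernel {α β : ℝ → ℝ} (h : IsDensityPair α β) (f g : ℂ[X]) :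
    Integrable (fun P : ℝ × ℝ => (f.eval (P.1 : ℂ) * α P.1) / ((P.2 : ℂ) - P.1) *
      (g.eval (P.2 : ℂ) * reflected β P.2)) (volume.prod volume) := by
  have hmono : ∀ i j : ℕ, Integrable (fun P : ℝ × ℝ => ((P.1 : ℂ) ^ i * α P.1) /
      ((P.2 : ℂ) - P.1) * ((P.2 : ℂ) ^ j * reflected β P.2)) (volume.prod volume) := by
    intro i j
    -- Reflecting y = -t turns 1 / (x + y) into -1 / (t - x), and the power of y contributes (-1)^j.
    have hmp : MeasurePreserving (fun P : ℝ × ℝ => (P.1, -P.2)) (volume.prod volume)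
        (volume.prod volume) :=
      (MeasurePreserving.id volume).prod (Measure.measurePreserving_neg volume)
    have h1 := (hmp.integrable_comp (h.bimoments i j).aestronglyMeasurable).2 (h.bimoments i j)
    refine ((h1.ofReal (𝕜 := ℂ)).const_mul (-(-1) ^ j)).congr (Eventually.of_forall fun P => ?_)
    simp only [Function.comp, reflected, RCLike.ofReal_eq_complex_ofReal]
    push_cast
    have h2 : (P.1 : ℂ) + -P.2 = -((P.2 : ℂ) - P.1) := by ring
    rw [h2, neg_pow (P.2 : ℂ), div_neg]
    have h3 : ((-1 : ℂ) ^ j) * (-1) ^ j = 1 := by rw [← mul_pow]; simp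
    linear_combination ((P.1 : ℂ) ^ i * α P.1 / ((P.2 : ℂ) - P.1) *
      ((P.2 : ℂ) ^ j * β (-P.2))) * h3
  induction f using Polynomial.induction_on' with
  | add f₁ f₂ h₁ h₂ =>
    refine (h₁.add h₂).congr (Eventually.of_forall fun P => ?_)
    simp only [Pi.add_apply, eval_add]
    ring
  | monomial i a =>
    induction g using Polynomial.induction_on' with
    | add g₁ g₂ h₁ h₂ =>
      refine (h₁.add h₂).congr (Eventually.of_forall fun P => ?_)
      simp only [Pi.add_apply, eval_add]
      ring
    | monomial j b =>
      refine ((hmono i j).const_mul (a * b)).congr (Eventually.of_forall fun P => ?_)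
      simp only [eval_monomial]
      ring

/-! ### Reconstruction of a function from its jump -/

/-- A function of slow growth is determined by its weak jump up to a polynomial. -/
theorem exists_polynomial_add_cauchyTransform {f : ℂ → ℂ}
    (hf : DifferentiableOn ℂ f {z : ℂ | z.im ≠ 0}) {A : ℝ} {k m : ℕ}
    (hb : ∀ z : ℂ, z.im ≠ 0 → ‖f z‖ ≤ A * (1 + ‖z‖) ^ k * (1 + |z.im|⁻¹) ^ m)
    {ρ : ℝ → ℂ} (hρ : Integrable ρ)
    (hj : ∀ φ : ℝ → ℂ, ContDiff ℝ ∞ φ → HasCompactSupport φ →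
      Tendsto (fun ε : ℝ => ∫ x : ℝ, φ x * (f (x + ε * Complex.I) - f (x - ε * Complex.I)))
        (𝓝[>] 0) (𝓝 (-2 * (Real.pi : ℂ) * Complex.I * ∫ x, φ x * ρ x))) :
    ∃ P : ℂ[X], ∀ z : ℂ, z.im ≠ 0 → f z = P.eval z + cauchyTransform ρ z := by
  have hA : 0 ≤ A := by
    have h1 := (norm_nonneg _).trans (hb Complex.I (by simp))
    have h2 : (0 : ℝ) < (1 + ‖Complex.I‖) ^ k * (1 + |Complex.I.im|⁻¹) ^ m := by positivity
    rw [mul_assoc] at h1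
    exact nonneg_of_mul_nonneg_left h1 h2
  have hC : DifferentiableOn ℂ (cauchyTransform ρ) {z : ℂ | z.im ≠ 0} := fun z hz =>
    (differentiableAt_cauchyTransform hρ (isSeparated_of_im_ne_zero ρ hz)).differentiableWithinAt
  -- The exponent m + 1 leaves room for the singularity 1 / |Im z| of the Cauchy transform.
  have key := exists_polynomial_of_weak_no_jump (f := fun z => f z - cauchyTransform ρ z)
    (hf.sub hC) (C := A + ∫ t, ‖ρ t‖) (k := k) (m := m + 1) ?_ ?_
  · obtain ⟨P, hP⟩ := key
    exact ⟨P, fun z hz => by rw [← hP z hz]; ring⟩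
  · intro z hz
    have h1 : (1 : ℝ) ≤ (1 + ‖z‖) ^ k := one_le_pow₀ (by simp)
    have h2 : (1 + |z.im|⁻¹) ^ m ≤ (1 + |z.im|⁻¹) ^ (m + 1) :=
      pow_le_pow_right₀ (by simp) (by omega)
    have h3 : |z.im|⁻¹ ≤ (1 + |z.im|⁻¹) ^ (m + 1) := by
      have h4 : (1 + |z.im|⁻¹) ^ 1 ≤ (1 + |z.im|⁻¹) ^ (m + 1) :=
        pow_le_pow_right₀ (by simp) (by omega)
      rw [pow_one] at h4
      linarith
    have hI : 0 ≤ ∫ t, ‖ρ t‖ := integral_nonneg fun t => norm_nonneg _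
    calc ‖f z - cauchyTransform ρ z‖
        ≤ A * (1 + ‖z‖) ^ k * (1 + |z.im|⁻¹) ^ m + (∫ t, ‖ρ t‖) * |z.im|⁻¹ :=
          (norm_sub_le _ _).trans (add_le_add (hb z hz) (norm_cauchyTransform_le hρ hz))
      _ ≤ A * (1 + ‖z‖) ^ k * (1 + |z.im|⁻¹) ^ (m + 1)
          + (∫ t, ‖ρ t‖) * (1 + ‖z‖) ^ k * (1 + |z.im|⁻¹) ^ (m + 1) := by
          have h5 : (∫ t, ‖ρ t‖) * 1 * |z.im|⁻¹ ≤
              (∫ t, ‖ρ t‖) * (1 + ‖z‖) ^ k * (1 + |z.im|⁻¹) ^ (m + 1) := by gcongr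
          rw [mul_one] at h5
          gcongr
      _ = _ := by ring
  · intro φ hφ hc
    have h1 := (hj φ hφ hc).sub (tendsto_integral_cauchyTransform_jump hρ hφ.continuous hc)
    rw [sub_self] at h1
    refine h1.congr' ?_
    filter_upwards [self_mem_nhdsWithin] with ε hε
    have hε0 : ε ≠ 0 := ne_of_gt hε
    have hint : ∀ g : ℂ → ℂ, DifferentiableOn ℂ g {z : ℂ | z.im ≠ 0} →
        Integrable fun x : ℝ => φ x * (g (x + ε * Complex.I) - g (x - ε * Complex.I)) := by
      intro g hg
      refine Continuous.integrable_of_hasCompactSupport (hφ.continuous.mul (Continuous.sub ?_ ?_))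
        hc.mul_right
      · exact hg.continuousOn.comp_continuous (by fun_prop) (by simpa using hε0)
      · exact hg.continuousOn.comp_continuous (by fun_prop) (by simpa using hε0)
    rw [← integral_sub (hint f hf) (hint _ hC)]
    refine integral_congr_ae (Eventually.of_forall fun x => ?_)
    simp only
    ring

/-- A function `f` of slow growth with weak jump `f₊ = f₋ - 2πi r g₋`, where `g` has dominated
boundary values. -/
theorem exists_polynomial_add_cauchyTransform_of_triangular {f g : ℂ → ℂ}
    (hf : DifferentiableOn ℂ f {z : ℂ | z.im ≠ 0}) {A : ℝ} {k m : ℕ}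
    (hb : ∀ z : ℂ, z.im ≠ 0 → ‖f z‖ ≤ A * (1 + ‖z‖) ^ k * (1 + |z.im|⁻¹) ^ m)
    (hg : ContinuousOn g {z : ℂ | z.im ≠ 0}) {r g₀ : ℝ → ℂ} (hr : AEStronglyMeasurable r volume)
    (hρ : Integrable fun x => g₀ x * r x)
    (hdom : ∀ K : Set ℝ, IsCompact K → ∃ B : ℝ → ℝ, Integrable B ∧ ∀ᵐ x : ℝ, x ∈ K →
      ∀ ε ∈ Set.Ioo (0 : ℝ) 1, ‖g (x - ε * Complex.I) * r x‖ ≤ B x)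
    (hlim : ∀ᵐ x : ℝ, Tendsto (fun ε : ℝ => g (x - ε * Complex.I) * r x) (𝓝[>] 0)
      (𝓝 (g₀ x * r x)))
    (hj : ∀ φ : ℝ → ℂ, ContDiff ℝ ∞ φ → HasCompactSupport φ →
      Tendsto (fun ε : ℝ => ∫ x : ℝ, φ x * (f (x + ε * Complex.I) -
        (g (x - ε * Complex.I) * (-2 * (Real.pi : ℂ) * Complex.I * r x)
          + f (x - ε * Complex.I)))) (𝓝[>] 0) (𝓝 0)) :
    ∃ P : ℂ[X], ∀ z : ℂ, z.im ≠ 0 →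
      f z = P.eval z + cauchyTransform (fun x => g₀ x * r x) z := by
  refine exists_polynomial_add_cauchyTransform hf hb hρ fun φ hφ hc => ?_
  obtain ⟨B, hB, hBb⟩ := hdom _ hc
  have hbound : ∀ ε ∈ Set.Ioo (0 : ℝ) 1, ∀ᵐ x : ℝ,
      ‖φ x * (g (x - ε * Complex.I) * r x)‖ ≤ ‖φ x‖ * B x := by
    intro ε hε
    filter_upwards [hBb] with x hx
    rw [norm_mul]
    by_cases hxs : x ∈ tsupport φ
    · exact mul_le_mul_of_nonneg_left (hx hxs ε hε) (norm_nonneg _)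
    · simp [image_eq_zero_of_notMem_tsupport hxs]
  have hmeas : ∀ ε ∈ Set.Ioo (0 : ℝ) 1, AEStronglyMeasurable
      (fun x : ℝ => φ x * (g (x - ε * Complex.I) * r x)) volume := by
    intro ε hε
    refine hφ.continuous.aestronglyMeasurable.mul (AEStronglyMeasurable.mul ?_ hr)
    exact (hg.comp_continuous (by fun_prop)
      (by simpa using hε.1.ne')).aestronglyMeasurable
  have hBi : Integrable fun x => ‖φ x‖ * B x := by
    obtain ⟨M, hM⟩ := hc.exists_bound_of_continuous hφ.continuous
    exact hB.bdd_mul hφ.continuous.norm.aestronglyMeasurable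
      (Eventually.of_forall fun x => by simpa using hM x)
  -- The boundary values of `g` exist in a dominated sense, so the product term in the weak jump
  -- converges to its integral against `g₀ r`, and the jump of `f` alone is -2πi g₀ r.
  have h1 : Tendsto (fun ε : ℝ => ∫ x : ℝ, φ x * (g (x - ε * Complex.I) * r x)) (𝓝[>] 0)
      (𝓝 (∫ x, φ x * (g₀ x * r x))) := by
    have hev : ∀ᶠ ε : ℝ in 𝓝[>] 0, ε ∈ Set.Ioo (0 : ℝ) 1 := Ioo_mem_nhdsGT one_pos
    refine tendsto_integral_filter_of_dominated_convergence (fun x => ‖φ x‖ * B x)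
      (hev.mono hmeas) (hev.mono hbound) hBi ?_
    filter_upwards [hlim] with x hx using hx.const_mul _
  have h2 := (hj φ hφ hc).add (h1.const_mul (-2 * (Real.pi : ℂ) * Complex.I))
  rw [zero_add] at h2
  refine h2.congr' ?_
  filter_upwards [Ioo_mem_nhdsGT one_pos] with ε hε
  have hε0 : ε ≠ 0 := hε.1.ne'
  have hi1 : Integrable fun x : ℝ => φ x * (f (x + ε * Complex.I) - f (x - ε * Complex.I)) := by
    refine Continuous.integrable_of_hasCompactSupport (hφ.continuous.mul (Continuous.sub ?_ ?_))
      hc.mul_right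
    · exact hf.continuousOn.comp_continuous (by fun_prop) (by simpa using hε0)
    · exact hf.continuousOn.comp_continuous (by fun_prop) (by simpa using hε0)
  have hi2 : Integrable fun x : ℝ => φ x * (g (x - ε * Complex.I) * r x) :=
    hBi.mono' (hmeas ε hε) (hbound ε hε)
  have hi3 : Integrable fun x : ℝ => φ x * (f (x + ε * Complex.I) -
      (g (x - ε * Complex.I) * (-2 * (Real.pi : ℂ) * Complex.I * r x)
        + f (x - ε * Complex.I))) := by
    refine (hi1.sub (hi2.const_mul (-2 * (Real.pi : ℂ) * Complex.I))).congr
      (Eventually.of_forall fun x => ?_)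
    simp only [Pi.sub_apply]
    ring
  rw [← integral_const_mul, ← integral_add hi3 (hi2.const_mul _)]
  refine integral_congr_ae (Eventually.of_forall fun x => ?_)
  simp only
  ring

/-! ### The columns of a solution -/

/-- The second column of a solution with first column `P`. -/
def middleColumn (α : ℝ → ℝ) (P : Fin 3 → ℂ[X]) (i : Fin 3) (z : ℂ) : ℂ :=
  (1 : Matrix (Fin 3) (Fin 3) ℂ) i 1 + cauchyTransform (fun t => (P i).eval (t : ℂ) * α t) z

/-- The density of the third column of a solution with first column `P`. -/
def lastDensity (α β : ℝ → ℝ) (P : Fin 3 → ℂ[X]) (i : Fin 3) (t : ℝ) : ℂ :=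
  middleColumn α P i t * reflected β t

/-- The third column of a solution with first column `P`. -/
def lastColumn (α β : ℝ → ℝ) (P R : Fin 3 → ℂ[X]) (i : Fin 3) (z : ℂ) : ℂ :=
  (R i).eval z + cauchyTransform (lastDensity α β P i) z

/-! ### Separation of the supports and integrability of the third-column density -/

theorem im_ne_zero_subset_offSupports (α β : ℝ → ℝ) :
    {z : ℂ | z.im ≠ 0} ⊆ offSupports α β := by
  rintro z hz ⟨t, -, rfl⟩
  simp at hz

theorem isSeparated_left_of_mem_offSupports {α β : ℝ → ℝ} {z : ℂ} (hz : z ∈ offSupports α β) :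
    IsSeparated (fun t => (α t : ℂ)) z :=
  isSeparated_of_notMem (isClosed_tsupport α)
    (fun t ht => subset_tsupport α (fun h0 => ht (by simp [h0])))
    fun ⟨t, ht, h⟩ => hz ⟨t, Or.inl ht, h⟩

theorem isSeparated_right_of_mem_offSupports {α β : ℝ → ℝ} {z : ℂ} (hz : z ∈ offSupports α β) :
    IsSeparated (fun t => (reflected β t : ℂ)) z :=
  isSeparated_of_notMem (isClosed_tsupport (reflected β))
    (fun t ht => subset_tsupport (reflected β) (fun h0 => ht (by simp [h0])))
    fun ⟨t, ht, h⟩ => hz ⟨t, Or.inr ht, h⟩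

theorem isSeparated_left_of_neg {α : ℝ → ℝ} (hα : ∀ x < 0, α x = 0) {t : ℝ} (ht : t < 0) :
    IsSeparated (fun t => (α t : ℂ)) t := by
  refine ⟨-t, by linarith, fun s hs => ?_⟩
  have hs0 : 0 ≤ s := by
    by_contra! h
    exact hs (by simp [hα s h])
  rw [← Complex.ofReal_sub, Complex.norm_real, Real.norm_eq_abs, abs_of_nonpos (by linarith)]
  linarith

theorem isSeparated_right_of_pos {β : ℝ → ℝ} (hβ : ∀ x < 0, β x = 0) {t : ℝ} (ht : 0 < t) :
    IsSeparated (fun t => (reflected β t : ℂ)) t := by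
  refine ⟨t, ht, fun s hs => ?_⟩
  have hs0 : s ≤ 0 := by
    by_contra! h
    exact hs (by simp [reflected, hβ (-s) (by linarith)])
  rw [← Complex.ofReal_sub, Complex.norm_real, Real.norm_eq_abs, abs_of_nonneg (by linarith)]
  linarith

/-- The two closed half-lines share only the null set {0}. Off it, each point where β* does not
vanish is negative, where the Cauchy transforms of α are regular. -/
theorem ae_neg_or_reflected_eq_zero {β : ℝ → ℝ} (hβ : ∀ x < 0, β x = 0) :
    ∀ᵐ t : ℝ, t < 0 ∨ reflected β t = 0 := by
  filter_upwards [Measure.ae_ne volume (0 : ℝ)] with t ht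
  rcases lt_or_gt_of_ne ht with h | h
  · exact Or.inl h
  · exact Or.inr (hβ _ (by linarith))

/-- Near 0 the second column may be unbounded, but by Fubini its Cauchy part times β* has integrable
moments because the bimoments are finite; the constant part uses the moments of β*. -/
theorem hasMoments_lastDensity {α β : ℝ → ℝ} (h : IsDensityPair α β)
    (hβ : HasMoments fun t => (β t : ℂ)) (P : Fin 3 → ℂ[X]) (i : Fin 3) :
    HasMoments (lastDensity α β P i) := by
  intro n
  have h1 := (h.integrable_kernel (P i) (X ^ n)).integral_prod_right
  simp only [eval_pow, eval_X, integral_mul_const] at h1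
  refine ((hasMoments_reflected hβ n).const_mul ((1 : Matrix (Fin 3) (Fin 3) ℂ) i 1) |>.add
    h1).congr (Eventually.of_forall fun t => ?_)
  simp only [Pi.add_apply, lastDensity, middleColumn, cauchyTransform]
  ring

/-! ### Recovering the three columns from the jump -/

theorem IsRHPSolution.differentiableOn {α β : ℝ → ℝ} {N : ℕ} {Γ : ℂ → Matrix (Fin 3) (Fin 3) ℂ}
    (hΓ : IsRHPSolution α β N Γ) (i j : Fin 3) :
    DifferentiableOn ℂ (fun z => Γ z i j) {z : ℂ | z.im ≠ 0} :=
  (hΓ.analytic i j).mono (im_ne_zero_subset_offSupports α β)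

theorem IsRHPSolution.tendsto_ray {α β : ℝ → ℝ} {N : ℕ} {Γ : ℂ → Matrix (Fin 3) (Fin 3) ℂ}
    (hΓ : IsRHPSolution α β N Γ) (i j : Fin 3) :
    Tendsto (fun s : ℝ => Γ (s * Complex.I) i j *
      (![(((s : ℂ) * Complex.I) ^ N)⁻¹, 1, ((s : ℂ) * Complex.I) ^ N] : Fin 3 → ℂ) j) atTop
      (𝓝 ((1 : Matrix (Fin 3) (Fin 3) ℂ) i j)) := by
  have hcob : Tendsto (fun s : ℝ => (s : ℂ) * Complex.I) atTop (Bornology.cobounded ℂ) :=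
    tendsto_norm_atTop_iff_cobounded.1 tendsto_norm_ray
  have hray : Tendsto (fun s : ℝ => (s : ℂ) * Complex.I) atTop
      (Bornology.cobounded ℂ ⊓ 𝓟 {z : ℂ | 1 * ‖z‖ ≤ |z.im|}) :=
    tendsto_inf.2 ⟨hcob, tendsto_principal.2 (Eventually.of_forall fun s => by simp)⟩
  have h1 := (hΓ.asymptotics 1 one_pos i j).comp_tendsto hray
  have h2 := h1.trans_tendsto (tendsto_inv₀_cobounded.comp hcob)
  have h3 := h2.add_const ((1 : Matrix (Fin 3) (Fin 3) ℂ) i j)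
  rw [zero_add] at h3
  refine h3.congr fun s => ?_
  simp [Matrix.sub_apply, Matrix.mul_diagonal]

/-- The first column of V is e₁, so the first column of Γ has no weak jump. -/
theorem IsRHPSolution.exists_firstColumn {α β : ℝ → ℝ} {N : ℕ}
    {Γ : ℂ → Matrix (Fin 3) (Fin 3) ℂ} (hΓ : IsRHPSolution α β N Γ) :
    ∃ P : Fin 3 → ℂ[X], ∀ i, ∀ z : ℂ, z.im ≠ 0 → Γ z i 0 = (P i).eval z := by
  obtain ⟨A, k, m, hb⟩ := hΓ.slowGrowth
  have key : ∀ i, ∃ P : ℂ[X], ∀ z : ℂ, z.im ≠ 0 → Γ z i 0 = P.eval z := by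
    intro i
    refine exists_polynomial_of_weak_no_jump (hΓ.differentiableOn i 0)
      (fun z hz => hb z hz i 0) fun φ hφ hc => ?_
    simpa [Matrix.mul_apply, Fin.sum_univ_three, jumpMatrix] using hΓ.jump φ hφ hc i 0
  exact ⟨fun i => (key i).choose, fun i => (key i).choose_spec⟩

/-- The jump determines the column up to a polynomial. Along the imaginary axis the Cauchy transform
vanishes and the column tends to e₂, so this polynomial is the constant e₂. -/
theorem IsRHPSolution.eq_middleColumn {α β : ℝ → ℝ} {N : ℕ}
    {Γ : ℂ → Matrix (Fin 3) (Fin 3) ℂ} (hΓ : IsRHPSolution α β N Γ)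
    (hα : HasMoments fun t => (α t : ℂ)) {P : Fin 3 → ℂ[X]}
    (hP : ∀ i, ∀ z : ℂ, z.im ≠ 0 → Γ z i 0 = (P i).eval z) (i : Fin 3) {z : ℂ} (hz : z.im ≠ 0) :
    Γ z i 1 = middleColumn α P i z := by
  obtain ⟨A, k, m, hb⟩ := hΓ.slowGrowth
  have hi : Integrable fun x : ℝ => (P i).eval (x : ℂ) * α x := (hα.polynomial_mul (P i)).integrable
  have key := exists_polynomial_add_cauchyTransform_of_triangular (hΓ.differentiableOn i 1)
    (fun z hz => hb z hz i 1) (hΓ.differentiableOn i 0).continuousOn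
    (r := fun x => (α x : ℂ)) (g₀ := fun x => (P i).eval (x : ℂ))
    hα.integrable.aestronglyMeasurable hi ?_ ?_ ?_
  · obtain ⟨Q, hQ⟩ := key
    have h1 : Tendsto (fun s : ℝ => Q.eval (s * Complex.I)) atTop
        (𝓝 ((1 : Matrix (Fin 3) (Fin 3) ℂ) i 1)) := by
      have h2 := (hΓ.tendsto_ray i 1).sub (tendsto_cauchyTransform_ray hi)
      rw [sub_zero] at h2
      refine h2.congr' ?_
      filter_upwards [eventually_gt_atTop 0] with s hs
      rw [hQ _ (by simp [hs.ne'])]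
      simp
    rw [hQ z hz, eq_C_of_tendsto_ray h1, eval_C, middleColumn]
  · intro K hK
    obtain ⟨M, hM⟩ := (hK.prod (isCompact_Icc (a := (0 : ℝ)) (b := 1))).exists_bound_of_continuousOn
      (f := fun y : ℝ × ℝ => (P i).eval ((y.1 : ℂ) - y.2 * Complex.I))
      (Continuous.continuousOn (by fun_prop))
    refine ⟨fun x => M * ‖(α x : ℂ)‖, hα.integrable.norm.const_mul M,
      Eventually.of_forall fun x hx ε hε => ?_⟩
    rw [norm_mul, hP i _ (by simpa using hε.1.ne')]
    exact mul_le_mul_of_nonneg_right (hM (x, ε) ⟨hx, hε.1.le, hε.2.le⟩) (norm_nonneg _)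
  · refine Eventually.of_forall fun x => Tendsto.mul_const _ ?_
    have h1 : Tendsto (fun ε : ℝ => (P i).eval ((x : ℂ) - ε * Complex.I)) (𝓝[>] 0)
        (𝓝 ((P i).eval (x : ℂ))) := by
      refine tendsto_nhdsWithin_of_tendsto_nhds ?_
      have : Continuous fun ε : ℝ => (P i).eval ((x : ℂ) - ε * Complex.I) := by fun_prop
      simpa using this.tendsto 0
    refine h1.congr' ?_
    filter_upwards [self_mem_nhdsWithin] with ε hε
    exact (hP i _ (by simpa using ne_of_gt hε)).symm
  · intro φ hφ hc
    simpa [Matrix.mul_apply, Fin.sum_univ_three, jumpMatrix] using hΓ.jump φ hφ hc i 1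

theorem continuousAt_middleColumn {α : ℝ → ℝ} (hα : HasMoments fun t => (α t : ℂ))
    (P : Fin 3 → ℂ[X]) (i : Fin 3) {z : ℂ} (hz : IsSeparated (fun t => (α t : ℂ)) z) :
    ContinuousAt (middleColumn α P i) z :=
  continuousAt_const.add (differentiableAt_cauchyTransform
    (hα.polynomial_mul (P i)).integrable (hz.mul_left _)).continuousAt

/-- The jump of the third column is -2πi times the second column times β*. The polynomial part is
left undetermined here: the normalization would make it e₃ for N = 0 and 0 otherwise, and keeping it
avoids this distinction. -/
theorem IsRHPSolution.exists_lastColumn {α β : ℝ → ℝ} {N : ℕ}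
    {Γ : ℂ → Matrix (Fin 3) (Fin 3) ℂ} (hΓ : IsRHPSolution α β N Γ) (h : IsDensityPair α β)
    (hα : HasMoments fun t => (α t : ℂ)) (hβ : HasMoments fun t => (β t : ℂ)) {P : Fin 3 → ℂ[X]}
    (hP : ∀ i, ∀ z : ℂ, z.im ≠ 0 → Γ z i 0 = (P i).eval z) :
    ∃ R : Fin 3 → ℂ[X], ∀ i, ∀ z : ℂ, z.im ≠ 0 → Γ z i 2 = lastColumn α β P R i z := by
  obtain ⟨A, k, m, hb⟩ := hΓ.slowGrowth
  have hmid : ∀ i, ∀ z : ℂ, z.im ≠ 0 → Γ z i 1 = middleColumn α P i z :=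
    fun i z hz => hΓ.eq_middleColumn hα hP i hz
  have key : ∀ i, ∃ R : ℂ[X], ∀ z : ℂ, z.im ≠ 0 →
      Γ z i 2 = R.eval z + cauchyTransform (lastDensity α β P i) z := by
    intro i
    refine exists_polynomial_add_cauchyTransform_of_triangular (hΓ.differentiableOn i 2)
      (fun z hz => hb z hz i 2) (hΓ.differentiableOn i 1).continuousOn
      (r := fun x => (reflected β x : ℂ)) (g₀ := fun x => middleColumn α P i x)
      (hasMoments_reflected hβ).integrable.aestronglyMeasurable
      (hasMoments_lastDensity h hβ P i).integrable ?_ ?_ ?_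
    · intro K _
      have hker := h.integrable_kernel (P i) 1
      -- The dominating function is an absolute bimoment integrated in x. It works because t < 0 ≤ x
      -- wherever the densities matter: moving t down by iε only enlarges |t - x|.
      refine ⟨fun t => ‖(1 : Matrix (Fin 3) (Fin 3) ℂ) i 1‖ * ‖(reflected β t : ℂ)‖ + _,
        ((hasMoments_reflected hβ).integrable.norm.const_mul _).add
          hker.norm.integral_prod_right, ?_⟩
      filter_upwards [hker.prod_left_ae, ae_neg_or_reflected_eq_zero h.supp_right]
        with t ht ht0 _ ε hε
      rcases ht0 with ht0 | ht0
      · rw [hmid i _ (by simpa using hε.1.ne'), middleColumn, add_mul, cauchyTransform,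
          ← integral_mul_const]
        refine (norm_add_le _ _).trans (add_le_add (norm_mul _ _).le ?_)
        refine norm_integral_le_of_norm_le ht.norm (Eventually.of_forall fun x => ?_)
        by_cases hx : α x = 0
        · simp [hx]
        · have hx0 : 0 ≤ x := by
            by_contra! hneg
            exact hx (h.supp_left x hneg)
          have h1 : 0 < ‖(t : ℂ) - x‖ := by
            rw [norm_pos_iff, ← Complex.ofReal_sub]
            exact_mod_cast (by linarith : t - x < 0).ne
          have h2 : ‖(t : ℂ) - x‖ ≤ ‖(t : ℂ) - ε * Complex.I - x‖ := by
            have := Complex.abs_re_le_norm ((t : ℂ) - ε * Complex.I - x)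
            rw [← Complex.ofReal_sub, Complex.norm_real, Real.norm_eq_abs]
            simpa using this
          rw [norm_mul, norm_mul, norm_div, norm_div, eval_one, one_mul]
          gcongr
      · simp [ht0]
    · filter_upwards [ae_neg_or_reflected_eq_zero h.supp_right] with t ht
      rcases ht with ht | ht
      · refine Tendsto.mul_const _ ?_
        have h1 : Tendsto (fun ε : ℝ => (t : ℂ) - ε * Complex.I) (𝓝[>] 0) (𝓝 (t : ℂ)) := by
          refine tendsto_nhdsWithin_of_tendsto_nhds ?_
          have : Continuous fun ε : ℝ => (t : ℂ) - ε * Complex.I := by fun_prop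
          simpa using this.tendsto 0
        refine ((continuousAt_middleColumn hα P i
          (isSeparated_left_of_neg h.supp_left ht)).tendsto.comp h1).congr' ?_
        filter_upwards [self_mem_nhdsWithin] with ε hε
        exact (hmid i _ (by simpa using ne_of_gt hε)).symm
      · simp [ht]
    · intro φ hφ hc
      simpa [Matrix.mul_apply, Fin.sum_univ_three, jumpMatrix] using hΓ.jump φ hφ hc i 2
  exact ⟨fun i => (key i).choose, fun i => (key i).choose_spec⟩

/-! ### Cross products of the columns -/

/-- The columns `P`, `middleColumn α P`, `lastColumn α β P R` satisfy the normalization at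
infinity, along the imaginary axis. -/
structure IsNormalized (α β : ℝ → ℝ) (N : ℕ) (P R : Fin 3 → ℂ[X]) : Prop where
  density : IsDensityPair α β
  moments_left : HasMoments fun t => (α t : ℂ)
  moments_right : HasMoments fun t => (β t : ℂ)
  ray_first : ∀ i, Tendsto (fun s : ℝ => (P i).eval (s * Complex.I) / (s * Complex.I) ^ N) atTop
    (𝓝 ((1 : Matrix (Fin 3) (Fin 3) ℂ) i 0))
  ray_last : ∀ i, Tendsto (fun s : ℝ => lastColumn α β P R i (s * Complex.I) *
    (s * Complex.I) ^ N) atTop (𝓝 ((1 : Matrix (Fin 3) (Fin 3) ℂ) i 2))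

theorem tendsto_middleColumn_ray {α : ℝ → ℝ} (hα : HasMoments fun t => (α t : ℂ))
    (P : Fin 3 → ℂ[X]) (i : Fin 3) :
    Tendsto (fun s : ℝ => middleColumn α P i (s * Complex.I)) atTop
      (𝓝 ((1 : Matrix (Fin 3) (Fin 3) ℂ) i 1)) := by
  simpa using! (tendsto_cauchyTransform_ray (hα.polynomial_mul (P i)).integrable).const_add
    ((1 : Matrix (Fin 3) (Fin 3) ℂ) i 1)

/-- The polynomials `W` are the cross product of the first two columns. -/
def IsCrossPolynomial (α : ℝ → ℝ) (P W : Fin 3 → ℂ[X]) : Prop :=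
  ∀ i z, IsSeparated (fun t => (α t : ℂ)) z → (W i).eval z =
    (P (i + 1)).eval z * middleColumn α P (i + 2) z
      - (P (i + 2)).eval z * middleColumn α P (i + 1) z

/-- The cross product of the first two columns is a polynomial. -/
theorem exists_crossPolynomial {α : ℝ → ℝ} (hα : HasMoments fun t => (α t : ℂ))
    (P : Fin 3 → ℂ[X]) :
    ∃ W : Fin 3 → ℂ[X], IsCrossPolynomial α P W := by
  choose D hD using fun j k : Fin 3 =>
    exists_polynomial_mul_cauchyTransform (hα.polynomial_mul (P k)) (P j)
  refine ⟨fun i => P (i + 1) * C ((1 : Matrix (Fin 3) (Fin 3) ℂ) (i + 2) 1)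
    - P (i + 2) * C ((1 : Matrix (Fin 3) (Fin 3) ℂ) (i + 1) 1)
    + D (i + 1) (i + 2) - D (i + 2) (i + 1), fun i z hz => ?_⟩
  have h1 := hD (i + 1) (i + 2) z (hz.mul_left _)
  have h2 := hD (i + 2) (i + 1) z (hz.mul_left _)
  -- Both Cauchy parts of the cross product have the density P_{i+1} P_{i+2} α, so they cancel.
  have h3 : (fun t : ℝ => (P (i + 1)).eval (t : ℂ) * ((P (i + 2)).eval (t : ℂ) * (α t : ℂ))) =
      fun t : ℝ => (P (i + 2)).eval (t : ℂ) * ((P (i + 1)).eval (t : ℂ) * (α t : ℂ)) := by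
    ext t; ring
  rw [h3] at h1
  simp only [middleColumn, eval_add, eval_sub, eval_mul, eval_C]
  linear_combination h2 - h1

theorem sum_cross_mul_first (a b : Fin 3 → ℂ) :
    ∑ i, (a (i + 1) * b (i + 2) - a (i + 2) * b (i + 1)) * a i = 0 := by
  simp only [Fin.sum_univ_three, Fin.isValue]
  rw [show (0 : Fin 3) + 1 = 1 from rfl, show (0 : Fin 3) + 2 = 2 from rfl,
    show (1 : Fin 3) + 1 = 2 from rfl, show (1 : Fin 3) + 2 = 0 from rfl,
    show (2 : Fin 3) + 1 = 0 from rfl, show (2 : Fin 3) + 2 = 1 from rfl]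
  ring

theorem sum_cross_mul_second (a b : Fin 3 → ℂ) :
    ∑ i, (a (i + 1) * b (i + 2) - a (i + 2) * b (i + 1)) * b i = 0 := by
  rw [← neg_eq_zero, ← Finset.sum_neg_distrib, ← sum_cross_mul_first b a]
  exact Finset.sum_congr rfl fun i _ => by ring

/-- Cyclic invariance of the 3 × 3 determinant with columns a, b, c. -/
theorem sum_cross_mul_rotate (a b c : Fin 3 → ℂ) :
    ∑ i, (a (i + 1) * b (i + 2) - a (i + 2) * b (i + 1)) * c i =
      ∑ i, (c (i + 1) * a (i + 2) - c (i + 2) * a (i + 1)) * b i := by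
  simp only [Fin.sum_univ_three, Fin.isValue]
  rw [show (0 : Fin 3) + 1 = 1 from rfl, show (0 : Fin 3) + 2 = 2 from rfl,
    show (1 : Fin 3) + 1 = 2 from rfl, show (1 : Fin 3) + 2 = 0 from rfl,
    show (2 : Fin 3) + 1 = 0 from rfl, show (2 : Fin 3) + 2 = 1 from rfl]
  ring

variable {α β : ℝ → ℝ} {N : ℕ} {P R W : Fin 3 → ℂ[X]}

theorem sum_crossPolynomial_mul_first
    (hW : IsCrossPolynomial α P W) {z : ℂ} (hz : z.im ≠ 0) :
    ∑ i, (W i).eval z * (P i).eval z = 0 := by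
  simp only [fun i => hW i z (isSeparated_of_im_ne_zero _ hz)]
  exact sum_cross_mul_first (fun i => (P i).eval z) fun i => middleColumn α P i z

theorem sum_crossPolynomial_mul_middle
    (hW : IsCrossPolynomial α P W) {z : ℂ}
    (hz : IsSeparated (fun t => (α t : ℂ)) z) :
    ∑ i, (W i).eval z * middleColumn α P i z = 0 := by
  simp only [fun i => hW i z hz]
  exact sum_cross_mul_second (fun i => (P i).eval z) fun i => middleColumn α P i z

/-- The determinant of the three columns is `1`. -/
theorem IsNormalized.sum_crossPolynomial_mul_last (h : IsNormalized α β N P R)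
    (hW : IsCrossPolynomial α P W) {z : ℂ} (hz : z.im ≠ 0) :
    ∑ i, (W i).eval z * lastColumn α β P R i z = 1 := by
  have hσ := hasMoments_lastDensity h.density h.moments_right P
  choose D hD using fun i => exists_polynomial_mul_cauchyTransform (hσ i) (W i)
  have hpoly : ∀ w : ℂ, w.im ≠ 0 → ∑ i, (W i).eval w * lastColumn α β P R i w =
      (∑ i, (W i * R i + D i)).eval w := by
    intro w hw
    -- The combined density is (W · M) β*, which vanishes because a cross product is orthogonal to
    -- its factors.
    have h0 : ∑ i, cauchyTransform
        (fun t : ℝ => (W i).eval (t : ℂ) * lastDensity α β P i t) w = 0 := by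
      rw [← cauchyTransform_sum _ (fun i _ => ((hσ i).polynomial_mul (W i)).integrable)
        fun i _ => isSeparated_of_im_ne_zero _ hw]
      refine integral_eq_zero_of_ae ?_
      filter_upwards [ae_neg_or_reflected_eq_zero h.density.supp_right] with t ht
      rcases ht with ht | ht
      · have h1 :=
          sum_crossPolynomial_mul_middle hW (isSeparated_left_of_neg h.density.supp_left ht)
        have h2 : ∑ i, (W i).eval (t : ℂ) * lastDensity α β P i t =
            (∑ i, (W i).eval (t : ℂ) * middleColumn α P i t) * reflected β t := by
          rw [Finset.sum_mul]
          exact Finset.sum_congr rfl fun i _ => by rw [lastDensity]; ring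
        simp [h2, h1]
      · simp [lastDensity, ht]
    rw [eval_finsetSum, ← add_zero (∑ i, eval w (W i * R i + D i)), ← h0,
      ← Finset.sum_add_distrib]
    refine Finset.sum_congr rfl fun i _ => ?_
    have h1 := hD i w (isSeparated_of_im_ne_zero _ hw)
    simp only [lastColumn, eval_add, eval_mul]
    linear_combination h1
  -- The powers z^N and z^{-N} of the first and last columns cancel, and the limit is the
  -- determinant of the identity.
  have hlim : Tendsto (fun s : ℝ => (∑ i, (W i * R i + D i)).eval (s * Complex.I)) atTop
      (𝓝 (∑ i : Fin 3, ((1 : Matrix (Fin 3) (Fin 3) ℂ) (i + 1) 0 *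
        (1 : Matrix (Fin 3) (Fin 3) ℂ) (i + 2) 1 - (1 : Matrix (Fin 3) (Fin 3) ℂ) (i + 2) 0 *
        (1 : Matrix (Fin 3) (Fin 3) ℂ) (i + 1) 1) * (1 : Matrix (Fin 3) (Fin 3) ℂ) i 2)) := by
    have hm := tendsto_middleColumn_ray h.moments_left P
    have h1 := tendsto_finsetSum Finset.univ fun (i : Fin 3) _ =>
      (((h.ray_first (i + 1)).mul (hm (i + 2))).sub
        ((h.ray_first (i + 2)).mul (hm (i + 1)))).mul (h.ray_last i)
    refine h1.congr' ?_
    filter_upwards [eventually_gt_atTop 0] with s hs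
    have hs1 : ((s : ℂ) * Complex.I).im ≠ 0 := by simp [hs.ne']
    have hs0 : (s : ℂ) * Complex.I ≠ 0 := by simp [hs.ne']
    rw [← hpoly _ hs1]
    refine Finset.sum_congr rfl fun i _ => ?_
    rw [hW i _ (isSeparated_of_im_ne_zero _ hs1)]
    field_simp
  rw [hpoly z hz, eq_C_of_tendsto_ray hlim, eval_C]
  simp [Matrix.one_apply]

/-- The cross product of the last and the first column. -/
theorem IsNormalized.cross_last_first (h : IsNormalized α β N P R)
    (hW : IsCrossPolynomial α P W) (i : Fin 3) {z : ℂ} (hz : z.im ≠ 0) :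
    lastColumn α β P R (i + 1) z * (P (i + 2)).eval z
      - lastColumn α β P R (i + 2) z * (P (i + 1)).eval z =
    (1 : Matrix (Fin 3) (Fin 3) ℂ) i 1
      - cauchyTransform (fun t : ℝ => (W i).eval (t : ℂ) * reflected β t) z := by
  have hσ := hasMoments_lastDensity h.density h.moments_right P
  have hWb := (hasMoments_reflected h.moments_right).polynomial_mul (W i)
  obtain ⟨D, hD⟩ := exists_polynomial_mul_cauchyTransform (hσ (i + 1)) (P (i + 2))
  obtain ⟨E, hE⟩ := exists_polynomial_mul_cauchyTransform (hσ (i + 2)) (P (i + 1))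
  have hpoly : ∀ w : ℂ, w.im ≠ 0 → lastColumn α β P R (i + 1) w * (P (i + 2)).eval w
      - lastColumn α β P R (i + 2) w * (P (i + 1)).eval w =
      (R (i + 1) * P (i + 2) - R (i + 2) * P (i + 1) + D - E).eval w
        - cauchyTransform (fun t : ℝ => (W i).eval (t : ℂ) * reflected β t) w := by
    intro w hw
    have h1 := hD w (isSeparated_of_im_ne_zero _ hw)
    have h2 := hE w (isSeparated_of_im_ne_zero _ hw)
    -- Almost everywhere that β* does not vanish, P_{i+1} M_{i+2} - P_{i+2} M_{i+1} is W_i, so the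
    -- two Cauchy parts differ by the transform of W_i β*.
    have h3 : cauchyTransform
        (fun t : ℝ => (P (i + 1)).eval (t : ℂ) * lastDensity α β P (i + 2) t) w =
        cauchyTransform (fun t : ℝ => (W i).eval (t : ℂ) * reflected β t
          + (P (i + 2)).eval (t : ℂ) * lastDensity α β P (i + 1) t) w := by
      refine integral_congr_ae ?_
      filter_upwards [ae_neg_or_reflected_eq_zero h.density.supp_right] with t ht
      rcases ht with ht | ht
      · rw [hW i _ (isSeparated_left_of_neg h.density.supp_left ht), lastDensity, lastDensity]
        ring
      · simp [lastDensity, ht]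
    rw [cauchyTransform_add hWb.integrable ((hσ (i + 1)).polynomial_mul (P (i + 2))).integrable
      (isSeparated_of_im_ne_zero _ hw) (isSeparated_of_im_ne_zero _ hw)] at h3
    simp only [lastColumn, eval_add, eval_sub, eval_mul]
    linear_combination h1 - h2 - h3
  have hlim : Tendsto (fun s : ℝ =>
      (R (i + 1) * P (i + 2) - R (i + 2) * P (i + 1) + D - E).eval (s * Complex.I)) atTop
      (𝓝 ((1 : Matrix (Fin 3) (Fin 3) ℂ) (i + 1) 2 * (1 : Matrix (Fin 3) (Fin 3) ℂ) (i + 2) 0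
        - (1 : Matrix (Fin 3) (Fin 3) ℂ) (i + 2) 2 * (1 : Matrix (Fin 3) (Fin 3) ℂ) (i + 1) 0
        + 0)) := by
    have h1 := (((h.ray_last (i + 1)).mul (h.ray_first (i + 2))).sub
      ((h.ray_last (i + 2)).mul (h.ray_first (i + 1)))).add
      (tendsto_cauchyTransform_ray hWb.integrable)
    refine h1.congr' ?_
    filter_upwards [eventually_gt_atTop 0] with s hs
    have hs1 : ((s : ℂ) * Complex.I).im ≠ 0 := by simp [hs.ne']
    have hs0 : (s : ℂ) * Complex.I ≠ 0 := by simp [hs.ne']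
    have h2 := hpoly _ hs1
    rw [eq_sub_iff_add_eq] at h2
    rw [← h2]
    field_simp
  rw [hpoly z hz, eq_C_of_tendsto_ray hlim, eval_C]
  congr 1
  fin_cases i <;> simp [Matrix.one_apply]

/-- Multiplication by polynomials of low degree commutes with the Cauchy transform that defines the
last column. -/
theorem IsNormalized.mul_lastColumn (h : IsNormalized α β N P R) {g : ℂ[X]} (hg : g.degree < N)
    (i : Fin 3) {z : ℂ} (hz : z.im ≠ 0) : g.eval z * lastColumn α β P R i z =
      cauchyTransform (fun t : ℝ => g.eval (t : ℂ) * lastDensity α β P i t) z := by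
  have hσ := hasMoments_lastDensity h.density h.moments_right P i
  obtain ⟨D, hD⟩ := exists_polynomial_mul_cauchyTransform hσ g
  have hpoly : ∀ w : ℂ, w.im ≠ 0 → g.eval w * lastColumn α β P R i w = (g * R i + D).eval w +
      cauchyTransform (fun t : ℝ => g.eval (t : ℂ) * lastDensity α β P i t) w := by
    intro w hw
    have h1 := hD w (isSeparated_of_im_ne_zero _ hw)
    simp only [lastColumn, eval_add, eval_mul]
    linear_combination h1
  -- g = o(z^N) on the ray, while the last column times z^N stays bounded; this is where the degree
  -- restriction enters.
  have hlim : Tendsto (fun s : ℝ => (g * R i + D).eval (s * Complex.I)) atTop (𝓝 0) := by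
    have h1 := ((tendsto_eval_div_pow_ray hg).mul (h.ray_last i)).sub
      (tendsto_cauchyTransform_ray (hσ.polynomial_mul g).integrable)
    rw [zero_mul, sub_zero] at h1
    refine h1.congr' ?_
    filter_upwards [eventually_gt_atTop 0] with s hs
    have hs1 : ((s : ℂ) * Complex.I).im ≠ 0 := by simp [hs.ne']
    have hs0 : (s : ℂ) * Complex.I ≠ 0 := by simp [hs.ne']
    rw [eq_sub_of_add_eq (hpoly _ hs1).symm]
    field_simp
  rw [hpoly z hz, eq_C_of_tendsto_ray hlim]
  simp

/-- Division of `W(w) · P(z)` by `z - w`. -/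
theorem IsNormalized.exists_quotient (h : IsNormalized α β N P R)
    (hW : IsCrossPolynomial α P W) {w : ℂ} (hw : w.im ≠ 0) :
    ∃ K : ℂ[X], K.degree < N ∧
      (∀ z, ∑ i, (W i).eval w * (P i).eval z = (z - w) * K.eval z) ∧
      ∀ z, IsSeparated (fun t => (α t : ℂ)) z → ∑ i, (W i).eval w * middleColumn α P i z =
        (z - w) * cauchyTransform (fun t : ℝ => K.eval (t : ℂ) * α t) z := by
  set A : ℂ[X] := ∑ i, C ((W i).eval w) * P i with hA
  have hAe : ∀ z, A.eval z = ∑ i, (W i).eval w * (P i).eval z := fun z => by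
    simp [hA, eval_finsetSum]
  have hroot : A.IsRoot w := by
    rw [IsRoot, hAe, sum_crossPolynomial_mul_first hW hw]
  set K : ℂ[X] := A /ₘ (X - C w) with hK
  have hAK : (X - C w) * K = A := mul_divByMonic_eq_iff_isRoot.2 hroot
  have hAKe : ∀ z, A.eval z = (z - w) * K.eval z := fun z => by rw [← hAK]; simp
  have hAdeg : A.degree < ((N + 1 : ℕ) : WithBot ℕ) := by
    refine (degree_sum_le _ _).trans_lt ((Finset.sup_lt_iff (WithBot.bot_lt_coe _)).2 ?_)
    intro i _
    refine lt_of_le_of_lt ?_ (degree_lt_succ_of_tendsto_ray (h.ray_first i))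
    rw [C_mul']
    exact degree_smul_le _ _
  have hKdeg : K.degree < N := by
    rw [← hAK, degree_mul, degree_X_sub_C] at hAdeg
    by_cases hK0 : K = 0
    · rw [hK0, degree_zero]
      exact WithBot.bot_lt_coe N
    · rw [degree_eq_natDegree hK0] at hAdeg ⊢
      have : 1 + K.natDegree < N + 1 := by exact_mod_cast hAdeg
      exact_mod_cast (by omega : K.natDegree < N)
  have hKm := h.moments_left.polynomial_mul K
  -- Taking the factor z - w out of the Cauchy transform leaves a constant independent of z. It is
  -- zero in total, as setting z = w shows, because W(w) · M(w) = 0.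
  have hform : ∀ z, IsSeparated (fun t => (α t : ℂ)) z →
      ∑ i, (W i).eval w * middleColumn α P i z = (W 1).eval w +
        ((z - w) * cauchyTransform (fun t : ℝ => K.eval (t : ℂ) * α t) z
          - ∫ t : ℝ, K.eval (t : ℂ) * α t) := by
    intro z hz
    rw [← cauchyTransform_sub_mul hKm (hz.mul_left _)]
    have h1 : (fun t : ℝ => ((t : ℂ) - w) * (K.eval (t : ℂ) * α t)) =
        fun t : ℝ => ∑ i, (W i).eval w * ((P i).eval (t : ℂ) * α t) := by
      ext t
      rw [← mul_assoc, ← hAKe, hAe, Finset.sum_mul]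
      exact Finset.sum_congr rfl fun i _ => by ring
    rw [h1, cauchyTransform_sum (ρ := fun i t => (W i).eval w * ((P i).eval (t : ℂ) * α t)) _
      (fun i _ => (h.moments_left.polynomial_mul (P i)).integrable.const_mul _)
      fun i _ => (hz.mul_left _).mul_left _]
    simp only [cauchyTransform_const_mul, middleColumn, mul_add, Finset.sum_add_distrib]
    congr 1
    simp [Matrix.one_apply]
  refine ⟨K, hKdeg, fun z => (hAe z).symm.trans (hAKe z), fun z hz => ?_⟩
  have h0 := hform w (isSeparated_of_im_ne_zero _ hw)
  rw [sum_crossPolynomial_mul_middle hW (isSeparated_of_im_ne_zero _ hw)] at h0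
  rw [hform z hz]
  linear_combination -h0

/-! ### Identification of the kernel -/

/-- A real polynomial as a complex polynomial. -/
def complexify (f : ℝ[X]) : ℂ[X] := f.map (algebraMap ℝ ℂ)

/-- The complex polynomial `f(-z)`. -/
def reflectedPolynomial (f : ℝ[X]) : ℂ[X] := (complexify f).comp (-X)

theorem eval_complexify (f : ℝ[X]) (z : ℂ) : (complexify f).eval z = aeval z f :=
  eval_map_algebraMap f z

theorem eval_complexify_ofReal (f : ℝ[X]) (t : ℝ) :
    (complexify f).eval (t : ℂ) = (f.eval t : ℝ) := by
  rw [eval_complexify]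
  simpa using! aeval_algebraMap_apply_eq_algebraMap_eval (A := ℂ) t f

theorem eval_reflectedPolynomial (f : ℝ[X]) (z : ℂ) :
    (reflectedPolynomial f).eval z = (complexify f).eval (-z) := by
  simp [reflectedPolynomial, eval_comp]

theorem degree_reflectedPolynomial_lt {f : ℝ[X]} {n : ℕ} (h : f.natDegree < n) :
    (reflectedPolynomial f).degree < n := by
  refine degree_le_natDegree.trans_lt ?_
  have h1 : (reflectedPolynomial f).natDegree ≤ f.natDegree := by
    rw [reflectedPolynomial, natDegree_comp, natDegree_neg, natDegree_X, mul_one]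
    exact natDegree_map_le
  exact_mod_cast h1.trans_lt h

theorem integral_Ioi_eq_integral {E : Type*} [NormedAddCommGroup E] [NormedSpace ℝ E]
    {f : ℝ → E} (hf : ∀ x < 0, f x = 0) : ∫ x in Set.Ioi (0 : ℝ), f x = ∫ x, f x := by
  rw [← integral_Ici_eq_integral_Ioi]
  exact setIntegral_eq_integral_of_forall_compl_eq_zero fun x hx => hf x (by simpa using hx)

/-- Polynomials of degree less than `n` are combinations of any `n` polynomials of degrees
`0, …, n - 1`. -/
theorem exists_eq_sum_complexify {p : ℕ → ℝ[X]} (hdeg : ∀ j, (p j).natDegree = j)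
    (hlc : ∀ j, (p j).leadingCoeff ≠ 0) (n : ℕ) (f : ℂ[X]) (hf : f.degree < n) :
    ∃ a : ℕ → ℂ, f = ∑ j ∈ Finset.range n, C (a j) * complexify (p j) := by
  induction n generalizing f with
  | zero =>
    refine ⟨0, ?_⟩
    have : f = 0 := by
      by_contra h0
      rw [degree_eq_natDegree h0] at hf
      exact absurd (show f.natDegree < 0 by exact_mod_cast hf) (by omega)
    simp [this]
  | succ n ih =>
    have hc : (complexify (p n)).coeff n ≠ 0 := by
      have := hlc n
      rw [leadingCoeff, hdeg n] at this
      simpa [complexify, coeff_map] using this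
    have hd : (complexify (p n)).degree ≤ n := by
      refine degree_map_le.trans (degree_le_natDegree.trans ?_)
      rw [hdeg n]
    set c := f.coeff n / (complexify (p n)).coeff n with hcdef
    have h1 : (f - C c * complexify (p n)).degree < n := by
      rw [degree_lt_iff_coeff_zero]
      intro m hm
      rcases hm.eq_or_lt with rfl | hlt
      · rw [coeff_sub, coeff_C_mul, hcdef, div_mul_cancel₀ _ hc, sub_self]
      · rw [coeff_sub, coeff_C_mul,
          coeff_eq_zero_of_degree_lt (hd.trans_lt (by exact_mod_cast hlt)),
          coeff_eq_zero_of_degree_lt (hf.trans_le (by exact_mod_cast hlt)), mul_zero, sub_zero]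
    obtain ⟨a, ha⟩ := ih _ h1
    refine ⟨Function.update a n c, ?_⟩
    rw [Finset.sum_range_succ, Function.update_self, ← sub_eq_iff_eq_add, ha]
    refine Finset.sum_congr rfl fun j hj => ?_
    rw [Function.update_of_ne (Finset.mem_range.1 hj).ne]

/-! ### Biorthogonality and the coefficients of the quotient -/

variable {p q : ℕ → ℝ[X]}

/-- The biorthogonality relations in terms of Cauchy transforms. -/
theorem IsCauchyBOP.integral_cauchyTransform (hpq : IsCauchyBOP α β p q)
    (h : IsDensityPair α β) (j k : ℕ) :
    ∫ t : ℝ, cauchyTransform (fun x : ℝ => (complexify (p j)).eval (x : ℂ) * α x) t *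
      ((reflectedPolynomial (q k)).eval (t : ℂ) * reflected β t) =
      -(if j = k then 1 else 0) := by
  have hswap := integral_integral_swap (f := fun x t : ℝ =>
    ((complexify (p j)).eval (x : ℂ) * α x) / ((t : ℂ) - x) *
      ((reflectedPolynomial (q k)).eval (t : ℂ) * reflected β t))
    (h.integrable_kernel (complexify (p j)) (reflectedPolynomial (q k)))
  simp only [integral_mul_const] at hswap
  simp only [cauchyTransform]
  rw [← hswap]
  have h1 : ∀ x : ℝ, (∫ t : ℝ, ((complexify (p j)).eval (x : ℂ) * α x) / ((t : ℂ) - x) *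
      ((reflectedPolynomial (q k)).eval (t : ℂ) * reflected β t)) =
      ((-∫ y in Set.Ioi (0 : ℝ),
        (p j).eval x * (q k).eval y / (x + y) * (α x * β y) : ℝ) : ℂ) := by
    intro x
    rw [integral_Ioi_eq_integral (fun y hy => by simp [h.supp_right y hy]),
      ← integral_neg_eq_self, ← integral_neg, ← integral_complex_ofReal]
    refine integral_congr_ae (Eventually.of_forall fun y => ?_)
    simp only [eval_reflectedPolynomial, reflected, Complex.ofReal_neg, neg_neg,
      eval_complexify_ofReal]
    push_cast
    rw [show -(y : ℂ) - x = -(x + y) by ring, div_neg]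
    ring
  simp only [h1]
  rw [integral_complex_ofReal, integral_neg, ← integral_Ioi_eq_integral (fun x hx => by
    simp [h.supp_left x hx]), hpq.biorthonormal j k]
  split_ifs <;> simp

/-- The quotient K of W(w) · P(z) by z - w is expanded in the p_j with j < N. Its coefficients are
found by evaluating in two ways the integral of C[K α] against q_k(-t) β*(t). -/
theorem IsNormalized.sum_mul_first_and_middle (h : IsNormalized α β N P R)
    (hW : IsCrossPolynomial α P W) (hpq : IsCauchyBOP α β p q) {w : ℂ} (hw : w.im ≠ 0) :
    (∀ z, ∑ i, (W i).eval w * (P i).eval z = (z - w) * ∑ j ∈ Finset.range N,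
      (reflectedPolynomial (q j)).eval w * (complexify (p j)).eval z) ∧
    ∀ z, IsSeparated (fun t => (α t : ℂ)) z → ∑ i, (W i).eval w * middleColumn α P i z =
      (z - w) * ∑ j ∈ Finset.range N, (reflectedPolynomial (q j)).eval w *
        cauchyTransform (fun t : ℝ => (complexify (p j)).eval (t : ℂ) * α t) z := by
  obtain ⟨K, hKd, hK1, hK2⟩ := h.exists_quotient hW hw
  obtain ⟨a, ha⟩ := exists_eq_sum_complexify hpq.natDegree_left
    (fun j => (hpq.leadingCoeff_pos j).ne') N K hKd
  have hKe : ∀ z, K.eval z = ∑ j ∈ Finset.range N, a j * (complexify (p j)).eval z := by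
    intro z
    rw [ha, eval_finsetSum]
    simp
  have hKc : ∀ z, IsSeparated (fun t => (α t : ℂ)) z →
      cauchyTransform (fun t : ℝ => K.eval (t : ℂ) * α t) z = ∑ j ∈ Finset.range N,
        a j * cauchyTransform (fun t : ℝ => (complexify (p j)).eval (t : ℂ) * α t) z := by
    intro z hz
    simp only [hKe, Finset.sum_mul, mul_assoc]
    rw [cauchyTransform_sum (ρ := fun j t => a j * ((complexify (p j)).eval (t : ℂ) * α t)) _
      (fun j _ => (h.moments_left.polynomial_mul _).integrable.const_mul _)
      fun j _ => (hz.mul_left _).mul_left _]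
    simp only [cauchyTransform_const_mul]
  have hcoef : ∀ k ∈ Finset.range N, a k = (reflectedPolynomial (q k)).eval w := by
    intro k hk
    set g := reflectedPolynomial (q k) with hg
    have hgd : g.degree < N := degree_reflectedPolynomial_lt (by
      rw [hpq.natDegree_right]; exact Finset.mem_range.1 hk)
    have hint : ∀ f : ℂ[X], Integrable fun t : ℝ =>
        cauchyTransform (fun x : ℝ => f.eval (x : ℂ) * α x) t *
          (g.eval (t : ℂ) * reflected β t) := by
      intro f
      have := (h.density.integrable_kernel f g).integral_prod_right
      simpa only [integral_mul_const] using! this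
    have hσ := hasMoments_lastDensity h.density h.moments_right P
    -- First evaluation, by biorthogonality.
    have h1 : ∫ t : ℝ, cauchyTransform (fun x : ℝ => K.eval (x : ℂ) * α x) t *
        (g.eval (t : ℂ) * reflected β t) = -a k := by
      have h2 : ∫ t : ℝ, cauchyTransform (fun x : ℝ => K.eval (x : ℂ) * α x) t *
          (g.eval (t : ℂ) * reflected β t) = ∫ t : ℝ, ∑ j ∈ Finset.range N, a j *
          (cauchyTransform (fun x : ℝ => (complexify (p j)).eval (x : ℂ) * α x) t *
            (g.eval (t : ℂ) * reflected β t)) := by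
        refine integral_congr_ae ?_
        filter_upwards [ae_neg_or_reflected_eq_zero h.density.supp_right] with t ht
        rcases ht with ht | ht
        · rw [hKc _ (isSeparated_left_of_neg h.density.supp_left ht), Finset.sum_mul]
          exact Finset.sum_congr rfl fun j _ => by ring
        · simp [ht]
      rw [h2, integral_finsetSum _ fun j _ => (hint _).const_mul _]
      simp only [integral_const_mul, hg, hpq.integral_cauchyTransform h.density]
      simp only [mul_neg, mul_ite, mul_one, mul_zero, Finset.sum_neg_distrib]
      rw [Finset.sum_ite_eq' _ k, if_pos hk]
    -- Second evaluation: C[K α](t) = W(w) · M(t) / (t - w) turns the integral into -W(w) · C[g M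
    -- β*](w). This is -g(w) W(w) · L(w) because deg g < N, and W · L = 1.
    have h3 : ∫ t : ℝ, cauchyTransform (fun x : ℝ => K.eval (x : ℂ) * α x) t *
        (g.eval (t : ℂ) * reflected β t) = -g.eval w := by
      have h4 : ∫ t : ℝ, cauchyTransform (fun x : ℝ => K.eval (x : ℂ) * α x) t *
          (g.eval (t : ℂ) * reflected β t) = ∫ t : ℝ, ∑ i, -(W i).eval w *
          ((g.eval (t : ℂ) * lastDensity α β P i t) / (w - t)) := by
        refine integral_congr_ae ?_
        filter_upwards [ae_neg_or_reflected_eq_zero h.density.supp_right] with t ht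
        have hwt : w - t ≠ 0 := fun h0 => hw (by
          have := congrArg Complex.im h0
          simpa using this)
        rcases ht with ht | ht
        · have h5 := hK2 t (isSeparated_left_of_neg h.density.supp_left ht)
          have h6 : ∑ i, -(W i).eval w * ((g.eval (t : ℂ) * lastDensity α β P i t) / (w - t)) =
              -(∑ i, (W i).eval w * middleColumn α P i t) *
                (g.eval (t : ℂ) * reflected β t) / (w - t) := by
            rw [neg_mul, neg_div, Finset.sum_mul, Finset.sum_div, ← Finset.sum_neg_distrib]
            exact Finset.sum_congr rfl fun i _ => by rw [lastDensity]; ring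
          rw [h6, h5]
          field_simp
          ring
        · simp [ht, lastDensity]
      rw [h4, integral_finsetSum _ fun i _ => (integrable_div_sub
        ((hσ i).polynomial_mul g).integrable (isSeparated_of_im_ne_zero _ hw)).const_mul _]
      simp only [integral_const_mul]
      have h7 : ∀ i, (∫ t : ℝ, (g.eval (t : ℂ) * lastDensity α β P i t) / (w - t)) =
          g.eval w * lastColumn α β P R i w := fun i => (h.mul_lastColumn hgd i hw).symm
      simp only [h7]
      have h8 := h.sum_crossPolynomial_mul_last hW hw
      calc ∑ i, -(W i).eval w * (g.eval w * lastColumn α β P R i w)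
          = -g.eval w * ∑ i, (W i).eval w * lastColumn α β P R i w := by
            rw [Finset.mul_sum]
            exact Finset.sum_congr rfl fun i _ => by ring
        _ = -g.eval w := by rw [h8, mul_one]
    exact neg_injective (h1.symm.trans h3)
  constructor
  · intro z
    rw [hK1, hKe]
    exact congrArg _ (Finset.sum_congr rfl fun j hj => by rw [hcoef j hj])
  · intro z hz
    rw [hK2 z hz, hKc z hz]
    exact congrArg _ (Finset.sum_congr rfl fun j hj => by rw [hcoef j hj])

/-- Both sides are polynomials in w, so the identity extends to real w. Real values are needed
because w becomes the integration variable in the second row of the inverse. -/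
theorem IsNormalized.sum_mul_first (h : IsNormalized α β N P R)
    (hW : IsCrossPolynomial α P W) (hpq : IsCauchyBOP α β p q) (w z : ℂ) :
    ∑ i, (W i).eval w * (P i).eval z = (z - w) * ∑ j ∈ Finset.range N,
      (reflectedPolynomial (q j)).eval w * (complexify (p j)).eval z :=
  congrFun (Continuous.ext_on dense_im_ne_zero (f := fun w => ∑ i, (W i).eval w * (P i).eval z)
    (g := fun w => (z - w) * ∑ j ∈ Finset.range N,
      (reflectedPolynomial (q j)).eval w * (complexify (p j)).eval z) (by fun_prop) (by fun_prop)
    fun _ hw => (h.sum_mul_first_and_middle hW hpq hw).1 z) w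

theorem IsNormalized.sum_mul_middle (h : IsNormalized α β N P R)
    (hW : IsCrossPolynomial α P W) (hpq : IsCauchyBOP α β p q) (w : ℂ) {z : ℂ}
    (hz : IsSeparated (fun t => (α t : ℂ)) z) :
    ∑ i, (W i).eval w * middleColumn α P i z = (z - w) * ∑ j ∈ Finset.range N,
      (reflectedPolynomial (q j)).eval w *
        cauchyTransform (fun t : ℝ => (complexify (p j)).eval (t : ℂ) * α t) z :=
  congrFun (Continuous.ext_on dense_im_ne_zero
    (f := fun w => ∑ i, (W i).eval w * middleColumn α P i z)
    (g := fun w => (z - w) * ∑ j ∈ Finset.range N, (reflectedPolynomial (q j)).eval w *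
      cauchyTransform (fun t : ℝ => (complexify (p j)).eval (t : ℂ) * α t) z)
    (by fun_prop) (by fun_prop)
    fun _ hw => (h.sum_mul_first_and_middle hW hpq hw).2 z hz) w

/-- The second row of the inverse, applied to a vector `v`. -/
theorem sum_secondRow_mul (hβ : HasMoments fun t => (β t : ℂ)) {v : Fin 3 → ℂ} {d : ℕ → ℂ}
    {z w : ℂ} (hz : z.im ≠ 0) (hw : w.im ≠ 0)
    (hv : ∀ t : ℂ, ∑ i, (W i).eval t * v i = (z - t) * ∑ j ∈ Finset.range N,
      (reflectedPolynomial (q j)).eval t * d j) :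
    ∑ i, ((1 : Matrix (Fin 3) (Fin 3) ℂ) i 1
      - cauchyTransform (fun t : ℝ => (W i).eval (t : ℂ) * reflected β t) w) * v i =
    ∑ i, ((1 : Matrix (Fin 3) (Fin 3) ℂ) i 1
      - cauchyTransform (fun t : ℝ => (W i).eval (t : ℂ) * reflected β t) z) * v i
    - (z - w) * ∑ j ∈ Finset.range N, d j *
      cauchyTransform (fun t : ℝ => (reflectedPolynomial (q j)).eval (t : ℂ) * reflected β t)
        w := by
  have hb := hasMoments_reflected hβ
  set G : ℂ[X] := ∑ j ∈ Finset.range N, C (d j) * reflectedPolynomial (q j) with hG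
  have hGe : ∀ t, G.eval t = ∑ j ∈ Finset.range N, (reflectedPolynomial (q j)).eval t * d j := by
    intro t
    rw [hG, eval_finsetSum]
    exact Finset.sum_congr rfl fun j _ => by rw [eval_mul, eval_C, mul_comm]
  have hGc : ∀ u : ℂ, u.im ≠ 0 →
      cauchyTransform (fun t : ℝ => G.eval (t : ℂ) * reflected β t) u =
      ∑ j ∈ Finset.range N, d j * cauchyTransform
        (fun t : ℝ => (reflectedPolynomial (q j)).eval (t : ℂ) * reflected β t) u := by
    intro u hu
    simp only [hGe, Finset.sum_mul]
    rw [cauchyTransform_sum (ρ := fun j t => (reflectedPolynomial (q j)).eval (t : ℂ) * d j *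
      reflected β t) _ ?_ fun j _ => isSeparated_of_im_ne_zero _ hu]
    · refine Finset.sum_congr rfl fun j _ => ?_
      rw [← cauchyTransform_const_mul]
      congr 1
      ext t
      ring
    · intro j _
      refine ((hb.polynomial_mul (reflectedPolynomial (q j))).integrable.const_mul (d j)).congr
        (Eventually.of_forall fun t => ?_)
      simp only
      ring
  -- Since W(t) · v = (z - t) G(t), the row at u applied to v is (u - z) C[G β*](u) plus a constant
  -- independent of u; comparing u = w with u = z removes the constant.
  have key : ∀ u : ℂ, u.im ≠ 0 → ∑ i, ((1 : Matrix (Fin 3) (Fin 3) ℂ) i 1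
      - cauchyTransform (fun t : ℝ => (W i).eval (t : ℂ) * reflected β t) u) * v i =
      v 1 + ((u - z) * cauchyTransform (fun t : ℝ => G.eval (t : ℂ) * reflected β t) u
        - ∫ t : ℝ, G.eval (t : ℂ) * reflected β t) := by
    intro u hu
    rw [← cauchyTransform_sub_mul (hb.polynomial_mul G) (isSeparated_of_im_ne_zero _ hu)]
    have h1 : (fun t : ℝ => ((t : ℂ) - z) * (G.eval (t : ℂ) * reflected β t)) =
        fun t : ℝ => ∑ i, -v i * ((W i).eval (t : ℂ) * reflected β t) := by
      ext t
      have h2 := hv t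
      rw [← hGe] at h2
      have h3 : ∑ i, -v i * ((W i).eval (t : ℂ) * reflected β t) =
          -(∑ i, (W i).eval (t : ℂ) * v i) * reflected β t := by
        rw [neg_mul, Finset.sum_mul, ← Finset.sum_neg_distrib]
        exact Finset.sum_congr rfl fun i _ => by ring
      rw [h3, h2]
      ring
    rw [h1, cauchyTransform_sum (ρ := fun i t => -v i * ((W i).eval (t : ℂ) * reflected β t)) _
      (fun i _ => (hb.polynomial_mul (W i)).integrable.const_mul _)
      fun i _ => isSeparated_of_im_ne_zero _ hu]
    simp only [cauchyTransform_const_mul]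
    simp only [sub_mul, Finset.sum_sub_distrib, neg_mul, Finset.sum_neg_distrib]
    rw [← sub_eq_add_neg]
    congr 1
    · simp [Matrix.one_apply]
    · exact Finset.sum_congr rfl fun i _ => mul_comm _ _
  rw [key w hw, key z hz, hGc w hw]
  ring

/-! ### The entries of the kernel -/

/-- The Cauchy transform of `f α`. -/
def leftTransform (α : ℝ → ℝ) (f : ℝ[X]) (z : ℂ) : ℂ :=
  cauchyTransform (fun t : ℝ => (complexify f).eval (t : ℂ) * α t) z

/-- The Cauchy transform of the reflection of `f β`. -/
def rightTransform (β : ℝ → ℝ) (f : ℝ[X]) (w : ℂ) : ℂ :=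
  cauchyTransform (fun t : ℝ => (reflectedPolynomial f).eval (t : ℂ) * reflected β t) w

theorem continuousAt_leftTransform (hα : HasMoments fun t => (α t : ℂ)) (f : ℝ[X]) {z : ℂ}
    (hz : IsSeparated (fun t => (α t : ℂ)) z) : ContinuousAt (leftTransform α f) z :=
  (differentiableAt_cauchyTransform (hα.polynomial_mul _).integrable
    (hz.mul_left _)).continuousAt

theorem continuousAt_rightTransform (hβ : HasMoments fun t => (β t : ℂ)) (f : ℝ[X]) {w : ℂ}
    (hw : IsSeparated (fun t => (reflected β t : ℂ)) w) : ContinuousAt (rightTransform β f) w :=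
  (differentiableAt_cauchyTransform ((hasMoments_reflected hβ).polynomial_mul _).integrable
    (hw.mul_left _)).continuousAt

/-- The entries of `Γ(w)⁻¹ Γ(z)` in terms of the biorthogonal polynomials, indexed as in the
matrix kernel. -/
def entry (α β : ℝ → ℝ) (p q : ℕ → ℝ[X]) (N : ℕ) (z w : ℂ) : Matrix (Fin 2) (Fin 2) ℂ :=
  !![(z - w) * ∑ j ∈ Finset.range N,
      (reflectedPolynomial (q j)).eval w * (complexify (p j)).eval z,
    (z - w) * ∑ j ∈ Finset.range N, (reflectedPolynomial (q j)).eval w * leftTransform α (p j) z;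
    -((z - w) * ∑ j ∈ Finset.range N, (complexify (p j)).eval z * rightTransform β (q j) w),
    1 - (z - w) * ∑ j ∈ Finset.range N, leftTransform α (p j) z * rightTransform β (q j) w]

theorem continuousAt_entry (hα : HasMoments fun t => (α t : ℂ))
    (hβ : HasMoments fun t => (β t : ℂ)) {z w : ℂ} (hz : IsSeparated (fun t => (α t : ℂ)) z)
    (hw : IsSeparated (fun t => (reflected β t : ℂ)) w) (μ ν : Fin 2) :
    ContinuousAt (fun x : ℂ × ℂ => entry α β p q N x.1 x.2 μ ν) (z, w) := by
  have hL : ∀ j, ContinuousAt (fun x : ℂ × ℂ => leftTransform α (p j) x.1) (z, w) := fun j =>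
    (continuousAt_leftTransform hα (p j) hz).comp_of_eq continuousAt_fst rfl
  have hR : ∀ j, ContinuousAt (fun x : ℂ × ℂ => rightTransform β (q j) x.2) (z, w) := fun j =>
    (continuousAt_rightTransform hβ (q j) hw).comp_of_eq continuousAt_snd rfl
  fin_cases μ <;> fin_cases ν <;> simp only [entry, Matrix.of_apply, Fin.zero_eta, Fin.mk_one,
    Matrix.cons_val_zero, Matrix.cons_val_one]
  · fun_prop
  · fun_prop
  · fun_prop
  · fun_prop

/-! ### The entries of Γ(w)⁻¹ Γ(z), off the real axis and then on the whole domain -/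

theorem IsRHPSolution.exists_isNormalized {Γ : ℂ → Matrix (Fin 3) (Fin 3) ℂ}
    (hΓ : IsRHPSolution α β N Γ) (h : IsDensityPair α β) (hpq : IsCauchyBOP α β p q) :
    ∃ P R : Fin 3 → ℂ[X], IsNormalized α β N P R ∧ ∀ i, ∀ z : ℂ, z.im ≠ 0 →
      Γ z i 0 = (P i).eval z ∧ Γ z i 1 = middleColumn α P i z ∧
        Γ z i 2 = lastColumn α β P R i z := by
  have hα := h.hasMoments hpq.not_ae_zero.2
  have hβ := h.symm.hasMoments hpq.not_ae_zero.1
  obtain ⟨P, hP⟩ := hΓ.exists_firstColumn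
  obtain ⟨R, hR⟩ := hΓ.exists_lastColumn h hα hβ hP
  refine ⟨P, R, ⟨h, hα, hβ, fun i => ?_, fun i => ?_⟩, fun i z hz =>
    ⟨hP i z hz, hΓ.eq_middleColumn hα hP i hz, hR i z hz⟩⟩
  · refine (hΓ.tendsto_ray i 0).congr' ?_
    filter_upwards [eventually_gt_atTop 0] with s hs
    rw [hP i _ (by simp [hs.ne'])]
    simp [div_eq_mul_inv]
  · refine (hΓ.tendsto_ray i 2).congr' ?_
    filter_upwards [eventually_gt_atTop 0] with s hs
    rw [hR i _ (by simp [hs.ne'])]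
    simp

/-- The position in the `3 × 3` matrix of the row `μ` of the kernel. -/
def rowIndex : Fin 2 → Fin 3 := ![2, 1]

/-- The position in the `3 × 3` matrix of the column `ν` of the kernel. -/
def colIndex : Fin 2 → Fin 3 := ![0, 1]

/-- The last two rows of the adjugate are the cross products L × P and P × M. For the second row
everything reduces to its value at w = z, which is (L × P) · P = 0 in the first column and (L × P) ·
M = det Γ(z) = 1 in the second. -/
theorem IsRHPSolution.det_and_adjugate_of_im_ne_zero {Γ : ℂ → Matrix (Fin 3) (Fin 3) ℂ}
    (hΓ : IsRHPSolution α β N Γ) (h : IsDensityPair α β) (hpq : IsCauchyBOP α β p q) {z w : ℂ}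
    (hz : z.im ≠ 0) (hw : w.im ≠ 0) : (Γ w).det = 1 ∧ ∀ μ ν : Fin 2,
      ((Γ w).adjugate * Γ z) (rowIndex μ) (colIndex ν) = entry α β p q N z w μ ν := by
  obtain ⟨P, R, hN, hcol⟩ := hΓ.exists_isNormalized h hpq
  obtain ⟨W, hW⟩ := exists_crossPolynomial hN.moments_left P
  have hrow2 : ∀ i, (Γ w).adjugate 2 i = (W i).eval w := by
    intro i
    rw [hW i w (isSeparated_of_im_ne_zero _ hw)]
    simp only [← (hcol _ w hw).1, ← (hcol _ w hw).2.1, Matrix.adjugate_fin_three]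
    fin_cases i <;> simp <;> ring
  have hrow1 : ∀ i, (Γ w).adjugate 1 i = (1 : Matrix (Fin 3) (Fin 3) ℂ) i 1
      - cauchyTransform (fun t : ℝ => (W i).eval (t : ℂ) * reflected β t) w := by
    intro i
    rw [← hN.cross_last_first hW i hw]
    simp only [← (hcol _ w hw).1, ← (hcol _ w hw).2.2, Matrix.adjugate_fin_three]
    fin_cases i <;> simp <;> ring
  have hself : ∀ v : Fin 3 → ℂ, ∑ i, ((1 : Matrix (Fin 3) (Fin 3) ℂ) i 1
      - cauchyTransform (fun t : ℝ => (W i).eval (t : ℂ) * reflected β t) z) * v i =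
      ∑ i, (lastColumn α β P R (i + 1) z * (P (i + 2)).eval z
        - lastColumn α β P R (i + 2) z * (P (i + 1)).eval z) * v i := fun v =>
    Finset.sum_congr rfl fun i _ => by rw [hN.cross_last_first hW i hz]
  refine ⟨?_, fun μ ν => ?_⟩
  · have h1 := hN.sum_crossPolynomial_mul_last hW hw
    simp only [← hrow2, ← (hcol _ w hw).2.2] at h1
    have h2 := congrFun (congrFun (Matrix.adjugate_mul (Γ w)) 2) 2
    rw [Matrix.mul_apply, h1] at h2
    simpa using h2.symm
  · rw [Matrix.mul_apply]
    fin_cases μ <;> fin_cases ν <;> simp only [rowIndex, colIndex, entry, Matrix.of_apply,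
      Fin.zero_eta, Fin.mk_one, Matrix.cons_val_zero, Matrix.cons_val_one, hrow2, hrow1,
      (hcol _ z hz).1, (hcol _ z hz).2.1]
    · exact hN.sum_mul_first hW hpq w z
    · exact hN.sum_mul_middle hW hpq w (isSeparated_of_im_ne_zero _ hz)
    · rw [sum_secondRow_mul hN.moments_right hz hw fun t => hN.sum_mul_first hW hpq t z, hself,
        sum_cross_mul_second (fun i => lastColumn α β P R i z) fun i => (P i).eval z, zero_sub]
      rfl
    · rw [sum_secondRow_mul hN.moments_right hz hw fun t =>
        hN.sum_mul_middle hW hpq t (isSeparated_of_im_ne_zero _ hz), hself,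
        ← sum_cross_mul_rotate (fun i => (P i).eval z) (fun i => middleColumn α P i z)
          fun i => lastColumn α β P R i z]
      congr 1
      rw [← hN.sum_crossPolynomial_mul_last hW hz]
      exact Finset.sum_congr rfl fun i _ => by rw [hW i z (isSeparated_of_im_ne_zero _ hz)]

theorem subset_closure_im_ne_zero (S : Set ℂ) : S ⊆ closure {z : ℂ | z.im ≠ 0} := fun z _ =>
  dense_im_ne_zero z

theorem IsRHPSolution.continuousOn {Γ : ℂ → Matrix (Fin 3) (Fin 3) ℂ}
    (hΓ : IsRHPSolution α β N Γ) : ContinuousOn Γ (offSupports α β) :=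
  continuousOn_pi.2 fun i => continuousOn_pi.2 fun j => (hΓ.analytic i j).continuousOn

theorem IsRHPSolution.det_eq_one {Γ : ℂ → Matrix (Fin 3) (Fin 3) ℂ}
    (hΓ : IsRHPSolution α β N Γ) (h : IsDensityPair α β) (hpq : IsCauchyBOP α β p q) {w : ℂ}
    (hw : w ∈ offSupports α β) : (Γ w).det = 1 := by
  have hdet : Continuous fun A : Matrix (Fin 3) (Fin 3) ℂ => A.det :=
    Continuous.matrix_det continuous_id
  have h1 : Set.EqOn (fun w => (Γ w).det) (fun _ => 1) (offSupports α β) :=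
    Set.EqOn.of_subset_closure (s := {z : ℂ | z.im ≠ 0})
      (fun w hw => (hΓ.det_and_adjugate_of_im_ne_zero h hpq hw hw).1)
      (hdet.comp_continuousOn hΓ.continuousOn) continuousOn_const
      (im_ne_zero_subset_offSupports α β) (subset_closure_im_ne_zero _)
  exact h1 hw

theorem IsRHPSolution.continuousOn_adjugate_mul_apply {Γ : ℂ → Matrix (Fin 3) (Fin 3) ℂ}
    (hΓ : IsRHPSolution α β N Γ) (i j : Fin 3) :
    ContinuousOn (fun x : ℂ × ℂ => ((Γ x.2).adjugate * Γ x.1) i j)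
      (offSupports α β ×ˢ offSupports α β) := by
  have hadj : Continuous fun A : Matrix (Fin 3) (Fin 3) ℂ => A.adjugate :=
    Continuous.matrix_adjugate continuous_id
  simp only [Matrix.mul_apply]
  refine continuousOn_finsetSum _ fun k _ => ContinuousOn.mul ?_ ?_
  · exact (hadj.matrix_elem i k).comp_continuousOn
      (hΓ.continuousOn.comp continuousOn_snd fun x hx => hx.2)
  · exact (hΓ.analytic k j).continuousOn.comp continuousOn_fst fun x hx => hx.1

/-- Both sides are continuous off the supports, and the non-real points are dense; this covers real
arguments in the gaps of the supports. -/
theorem IsRHPSolution.adjugate_mul_apply {Γ : ℂ → Matrix (Fin 3) (Fin 3) ℂ}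
    (hΓ : IsRHPSolution α β N Γ) (h : IsDensityPair α β) (hpq : IsCauchyBOP α β p q) {z w : ℂ}
    (hz : z ∈ offSupports α β) (hw : w ∈ offSupports α β) (μ ν : Fin 2) :
    ((Γ w).adjugate * Γ z) (rowIndex μ) (colIndex ν) = entry α β p q N z w μ ν := by
  have hα := h.hasMoments hpq.not_ae_zero.2
  have hβ := h.symm.hasMoments hpq.not_ae_zero.1
  have hcont : ContinuousOn (fun x : ℂ × ℂ => entry α β p q N x.1 x.2 μ ν)
      (offSupports α β ×ˢ offSupports α β) := fun x hx =>
    (continuousAt_entry hα hβ (isSeparated_left_of_mem_offSupports hx.1)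
      (isSeparated_right_of_mem_offSupports hx.2) μ ν).continuousWithinAt
  have hsub : {z : ℂ | z.im ≠ 0} ×ˢ {z : ℂ | z.im ≠ 0} ⊆ offSupports α β ×ˢ offSupports α β :=
    Set.prod_mono (im_ne_zero_subset_offSupports α β) (im_ne_zero_subset_offSupports α β)
  have hclosure : offSupports α β ×ˢ offSupports α β ⊆
      closure ({z : ℂ | z.im ≠ 0} ×ˢ {z : ℂ | z.im ≠ 0}) := by
    rw [closure_prod_eq]
    exact Set.prod_mono (subset_closure_im_ne_zero _) (subset_closure_im_ne_zero _)
  have heq : Set.EqOn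
      (fun x : ℂ × ℂ => ((Γ x.2).adjugate * Γ x.1) (rowIndex μ) (colIndex ν))
      (fun x => entry α β p q N x.1 x.2 μ ν) ({z : ℂ | z.im ≠ 0} ×ˢ {z : ℂ | z.im ≠ 0}) :=
    fun x hx => (hΓ.det_and_adjugate_of_im_ne_zero h hpq hx.1 hx.2).2 μ ν
  have h1 := heq.of_subset_closure (hΓ.continuousOn_adjugate_mul_apply _ _) hcont hsub hclosure
  have h2 := h1 (Set.mk_mem_prod hz hw)
  simpa only using h2

theorem IsRHPSolution.inv_mul_apply {Γ : ℂ → Matrix (Fin 3) (Fin 3) ℂ}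
    (hΓ : IsRHPSolution α β N Γ) (h : IsDensityPair α β) (hpq : IsCauchyBOP α β p q) {z w : ℂ}
    (hz : z ∈ offSupports α β) (hw : w ∈ offSupports α β) (μ ν : Fin 2) :
    ((Γ w)⁻¹ * Γ z) (rowIndex μ) (colIndex ν) = entry α β p q N z w μ ν := by
  rw [Matrix.inv_def, hΓ.det_eq_one h hpq hw, Ring.inverse_one, one_smul,
    hΓ.adjugate_mul_apply h hpq hz hw]

/-! ### The kernels of the correlation functions -/

theorem leftTransform_neg (hα : ∀ x < 0, α x = 0) (f : ℝ[X]) (y : ℝ) :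
    leftTransform α f (-y) =
      ((-∫ x in Set.Ioi (0 : ℝ), f.eval x * α x / (x + y) : ℝ) : ℂ) := by
  rw [integral_Ioi_eq_integral (fun x hx => by simp [hα x hx]), leftTransform, cauchyTransform,
    ← integral_neg, ← integral_complex_ofReal]
  refine integral_congr_ae (Eventually.of_forall fun x => ?_)
  simp only [eval_complexify_ofReal]
  push_cast
  rw [show -(y : ℂ) - x = -(x + y) by ring, div_neg]

theorem rightTransform_ofReal (hβ : ∀ x < 0, β x = 0) (f : ℝ[X]) (x : ℝ) :
    rightTransform β f x =
      ((∫ y in Set.Ioi (0 : ℝ), f.eval y * β y / (x + y) : ℝ) : ℂ) := by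
  rw [integral_Ioi_eq_integral (fun y hy => by simp [hβ y hy]), rightTransform, cauchyTransform,
    ← integral_neg_eq_self, ← integral_complex_ofReal]
  refine integral_congr_ae (Eventually.of_forall fun y => ?_)
  simp only [eval_reflectedPolynomial, reflected, Complex.ofReal_neg, neg_neg,
    eval_complexify_ofReal, sub_neg_eq_add]
  push_cast
  rfl

theorem transform_one (hα : ∀ x < 0, α x = 0) (f : ℝ[X]) (z : ℂ) :
    transform α f 1 z = leftTransform α f z := by
  rw [transform, integral_Ioi_eq_integral (fun x hx => by simp [hα x hx]), leftTransform,
    cauchyTransform]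
  simp only [eval_complexify_ofReal, Complex.ofReal_mul]

/-- Reflecting both the variable of integration and the argument changes the sign of the Cauchy
kernel. This is one source of the signs in the formulas for the kernels. -/
theorem leftTransform_neg_eq_rightTransform (hβ : ∀ x < 0, β x = 0) (f : ℝ[X]) (x : ℝ) :
    leftTransform β f (-x) = -rightTransform β f x := by
  rw [leftTransform_neg hβ, rightTransform_ofReal hβ]
  push_cast
  simp only [add_comm]

/-- The point -y lies at distance at least y from the support, so the kernel is bounded there. This
permits exchanging the finite sum over j with the integrals defining the kernels. -/
theorem integrableOn_div_add {ρ : ℝ → ℝ} (hm : HasMoments fun t => (ρ t : ℂ))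
    (hρ : ∀ x < 0, ρ x = 0) (f : ℝ[X]) {y : ℝ} (hy : 0 < y) :
    IntegrableOn (fun x => f.eval x * ρ x / (x + y)) (Set.Ioi 0) := by
  have h1 := integrable_div_sub (hm.polynomial_mul (complexify f)).integrable
    ((isSeparated_left_of_neg hρ (show -y < 0 by linarith)).mul_left _)
  have h2 : Integrable fun x => f.eval x * ρ x / (x + y) := by
    refine h1.re.neg.congr (Eventually.of_forall fun x => ?_)
    have h3 : ((complexify f).eval (x : ℂ) * ρ x) / ((-y : ℝ) - (x : ℂ)) =
        ((-(f.eval x * ρ x / (x + y)) : ℝ) : ℂ) := by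
      rw [eval_complexify_ofReal]
      push_cast
      rw [show -(y : ℂ) - x = -(x + y) by ring, div_neg]
    change -(((complexify f).eval (x : ℂ) * ρ x) / ((-y : ℝ) - (x : ℂ))).re = _
    rw [h3, Complex.ofReal_re, neg_neg]
  exact h2.integrableOn

theorem H10_eq_sum (hm : HasMoments fun t => (α t : ℂ)) (hα : ∀ x < 0, α x = 0) {y' : ℝ}
    (hy' : 0 < y') (y : ℝ) : (H10 α p q N y' y : ℂ) =
      -∑ j ∈ Finset.range N, (complexify (q j)).eval (y : ℂ) * leftTransform α (p j) (-y') := by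
  have h1 : H10 α p q N y' y = ∑ j ∈ Finset.range N, (q j).eval y *
      ∫ x in Set.Ioi (0 : ℝ), (p j).eval x * α x / (x + y') := by
    simp only [← integral_const_mul]
    rw [← integral_finsetSum _ fun j _ => (integrableOn_div_add hm hα (p j) hy').const_mul _, H10]
    refine integral_congr_ae (Eventually.of_forall fun x => ?_)
    simp only [H00, Finset.sum_mul, Finset.sum_div]
    exact Finset.sum_congr rfl fun j _ => by ring
  rw [h1, ← Finset.sum_neg_distrib]
  push_cast
  refine Finset.sum_congr rfl fun j _ => ?_
  rw [leftTransform_neg hα, eval_complexify_ofReal]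
  push_cast
  ring

theorem H01_eq_sum (hm : HasMoments fun t => (β t : ℂ)) (hβ : ∀ x < 0, β x = 0) (x : ℝ) {x' : ℝ}
    (hx' : 0 < x') : (H01 β p q N x x' : ℂ) =
      ∑ j ∈ Finset.range N, (complexify (p j)).eval (x : ℂ) * rightTransform β (q j) x' := by
  have h1 : H01 β p q N x x' = ∑ j ∈ Finset.range N, (p j).eval x *
      ∫ y in Set.Ioi (0 : ℝ), (q j).eval y * β y / (x' + y) := by
    simp only [← integral_const_mul, add_comm x']
    rw [← integral_finsetSum _ fun j _ => (integrableOn_div_add hm hβ (q j) hx').const_mul _, H01]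
    refine integral_congr_ae (Eventually.of_forall fun y => ?_)
    simp only [H00, Finset.sum_mul, Finset.sum_div]
    exact Finset.sum_congr rfl fun j _ => by rw [add_comm x' y]; ring
  rw [h1]
  push_cast
  refine Finset.sum_congr rfl fun j _ => ?_
  rw [rightTransform_ofReal hβ, eval_complexify_ofReal]

theorem H11_eq_sum (hmα : HasMoments fun t => (α t : ℂ)) (hα : ∀ x < 0, α x = 0)
    (hmβ : HasMoments fun t => (β t : ℂ)) (hβ : ∀ x < 0, β x = 0) {y x : ℝ} (hy : 0 < y)
    (hx : 0 < x) : (H11 α β p q N y x : ℂ) =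
      -∑ j ∈ Finset.range N, leftTransform α (p j) (-y) * rightTransform β (q j) x
        - 1 / ((x : ℂ) + y) := by
  have h1 : ∀ z : ℝ, (∫ w in Set.Ioi (0 : ℝ),
      H00 p q N z w * (α z * β w) / ((z + y) * (x + w))) =
      (∑ j ∈ Finset.range N, ((p j).eval z * α z / (z + y)) *
        ∫ w in Set.Ioi (0 : ℝ), (q j).eval w * β w / (w + x)) := by
    intro z
    simp only [← integral_const_mul]
    rw [← integral_finsetSum _ fun j _ => (integrableOn_div_add hmβ hβ (q j) hx).const_mul _]
    refine integral_congr_ae (Eventually.of_forall fun w => ?_)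
    simp only [H00, Finset.sum_mul, Finset.sum_div]
    refine Finset.sum_congr rfl fun j _ => ?_
    rw [div_mul_div_comm, add_comm x w]
    congr 1
    ring
  rw [H11]
  simp only [h1]
  rw [integral_finsetSum _ fun j _ => (integrableOn_div_add hmα hα (p j) hy).mul_const _]
  simp only [integral_mul_const]
  push_cast
  rw [← Finset.sum_neg_distrib]
  congr 1
  refine Finset.sum_congr rfl fun j _ => ?_
  rw [leftTransform_neg hα, rightTransform_ofReal hβ]
  simp only [add_comm x]
  push_cast
  ring

/-- A formula on pairs of distinct points off the supports that is continuous at `(a, b)` gives the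
value at `(a, b)`. -/
theorem hasValue_of_continuousAt {G E : ℂ → ℂ → ℂ} {a b L : ℂ}
    (hGE : ∀ z ∈ offSupports α β, ∀ w ∈ offSupports α β, z ≠ w → G z w = E z w)
    (hE : ContinuousAt (fun x : ℂ × ℂ => E x.1 x.2) (a, b)) (hL : E a b = L) :
    HasValue α β G a b L := by
  have h1 : Tendsto (fun x : ℂ × ℂ => E x.1 x.2) (𝓝[{x : ℂ × ℂ | x.1 ∈ offSupports α β ∧
      x.2 ∈ offSupports α β ∧ x.1 ≠ x.2}] (a, b)) (𝓝 L) := hL ▸ hE.tendsto.mono_left inf_le_left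
  refine h1.congr' ?_
  filter_upwards [self_mem_nhdsWithin] with x hx
  exact (hGE x.1 hx.1 x.2 hx.2.1 hx.2.2).symm

end

end CauchyTwoMatrix

/-! ### The four kernels as limits of the quotients -/

open CauchyTwoMatrix in
theorem mainTheorem3 (α β : ℝ → ℝ) (hαβ : IsDensityPair α β)
    (p q : ℕ → Polynomial ℝ) (hpq : IsCauchyBOP α β p q)
    (N : ℕ) (Γ : ℂ → Matrix (Fin 3) (Fin 3) ℂ) (hΓ : IsRHPSolution α β N Γ) :
    (∀ x y : ℝ, 0 < x → 0 < y →
      (H00 p q N x y : ℂ) = matrixKernel α β p q N x y 0 0 ∧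
      HasValue α β (fun z w => ((Γ w)⁻¹ * Γ z) 2 0 / (z - w)) x (-y) (H00 p q N x y)) ∧
    (∀ y' y : ℝ, 0 < y' → 0 < y →
      (H10 α p q N y' y : ℂ) = -matrixKernel α β p q N (-y') y 0 1 ∧
      HasValue α β (fun z w => ((Γ w)⁻¹ * Γ z) 2 1 / (w - z)) (-y') (-y) (H10 α p q N y' y)) ∧
    (∀ x x' : ℝ, 0 < x → 0 < x' →
      (H01 β p q N x x' : ℂ) = -matrixKernel α β p q N x (-x') 1 0 ∧
      HasValue α β (fun z w => ((Γ w)⁻¹ * Γ z) 1 0 / (w - z)) x x' (H01 β p q N x x')) ∧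
    (∀ y x : ℝ, 0 < y → 0 < x →
      (H11 α β p q N y x : ℂ) = matrixKernel α β p q N (-y) (-x) 1 1 ∧
      HasValue α β (fun z w => ((Γ w)⁻¹ * Γ z) 1 1 / (z - w)) (-y) x (H11 α β p q N y x)) := by
  have hmα := hαβ.hasMoments hpq.not_ae_zero.2
  have hmβ := hαβ.symm.hasMoments hpq.not_ae_zero.1
  have hα := hαβ.supp_left
  have hβ := hαβ.supp_right
  have hinv : ∀ z ∈ offSupports α β, ∀ w ∈ offSupports α β, ∀ μ ν : Fin 2,
      ((Γ w)⁻¹ * Γ z) (rowIndex μ) (colIndex ν) = entry α β p q N z w μ ν :=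
    fun z hz w hw μ ν => hΓ.inv_mul_apply hαβ hpq hz hw μ ν
  have hL : ∀ (y : ℝ), 0 < y → ∀ j, ContinuousAt (leftTransform α (p j)) (-(y : ℂ)) :=
    fun y hy j => continuousAt_leftTransform hmα (p j) (by
      simpa using isSeparated_left_of_neg hα (show -y < 0 by linarith))
  have hR : ∀ (x : ℝ), 0 < x → ∀ j, ContinuousAt (rightTransform β (q j)) (x : ℂ) :=
    fun x hx j => continuousAt_rightTransform hmβ (q j) (isSeparated_right_of_pos hβ hx)
  refine ⟨fun x y hx hy => ⟨?_, ?_⟩, fun y' y hy' hy => ⟨?_, ?_⟩, fun x x' hx hx' => ⟨?_, ?_⟩,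
    fun y x hy hx => ⟨?_, ?_⟩⟩
  · simp only [H00, matrixKernel, transform, Matrix.of_apply, ← eval_complexify,
      eval_complexify_ofReal, Complex.ofReal_sum, Complex.ofReal_mul]
    simp [mul_comm]
  -- After cancelling z - w the quotient is a polynomial expression, continuous everywhere and in
  -- particular on the supports.
  · refine hasValue_of_continuousAt (E := fun z w => ∑ j ∈ Finset.range N,
      (reflectedPolynomial (q j)).eval w * (complexify (p j)).eval z) ?_ ?_ ?_
    · intro z hz w hw hzw
      have h0 : z - w ≠ 0 := sub_ne_zero.2 hzw
      have h1 : ((Γ w)⁻¹ * Γ z) 2 0 = _ := hinv z hz w hw 0 0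
      rw [h1]
      simp only [entry, Matrix.of_apply, Matrix.cons_val_zero]
      field_simp
    · fun_prop
    · simp only [H00, eval_reflectedPolynomial, neg_neg, eval_complexify_ofReal, Complex.ofReal_sum,
        Complex.ofReal_mul, mul_comm]
  · rw [H10_eq_sum hmα hα hy']
    simp only [matrixKernel, Matrix.of_apply, transform_one hα]
    simp [transform, eval_complexify]
  · refine hasValue_of_continuousAt (E := fun z w => -∑ j ∈ Finset.range N,
      (reflectedPolynomial (q j)).eval w * leftTransform α (p j) z) ?_ ?_ ?_
    · intro z hz w hw hzw
      have h0 : w - z ≠ 0 := sub_ne_zero.2 hzw.symm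
      have h1 : ((Γ w)⁻¹ * Γ z) 2 1 = _ := hinv z hz w hw 0 1
      rw [h1]
      simp only [entry, Matrix.of_apply, Matrix.cons_val_zero, Matrix.cons_val_one]
      rw [div_eq_iff h0]
      ring
    · have := fun j => (hL y' hy' j).comp_of_eq (f := fun x : ℂ × ℂ => x.1)
        (x := (-(y' : ℂ), -(y : ℂ))) continuousAt_fst rfl
      simp only [Function.comp_def] at this
      fun_prop
    · rw [H10_eq_sum hmα hα hy']
      simp only [eval_reflectedPolynomial, neg_neg]
  · rw [H01_eq_sum hmβ hβ x hx']
    simp only [matrixKernel, Matrix.of_apply, transform_one hβ,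
      leftTransform_neg_eq_rightTransform hβ]
    simp [transform, eval_complexify, mul_comm]
  -- This form has no pole at z = w, which settles the case x = x'.
  · refine hasValue_of_continuousAt (E := fun z w => ∑ j ∈ Finset.range N,
      (complexify (p j)).eval z * rightTransform β (q j) w) ?_ ?_ ?_
    · intro z hz w hw hzw
      have h0 : w - z ≠ 0 := sub_ne_zero.2 hzw.symm
      have h1 : ((Γ w)⁻¹ * Γ z) 1 0 = _ := hinv z hz w hw 1 0
      rw [h1]
      simp only [entry, Matrix.of_apply, Matrix.cons_val_zero, Matrix.cons_val_one]
      rw [div_eq_iff h0]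
      ring
    · have := fun j => (hR x' hx' j).comp_of_eq (f := fun x : ℂ × ℂ => x.2)
        (x := ((x : ℂ), (x' : ℂ))) continuousAt_snd rfl
      simp only [Function.comp_def] at this
      fun_prop
    · rw [H01_eq_sum hmβ hβ x hx']
  · rw [H11_eq_sum hmα hα hmβ hβ hy hx]
    simp only [matrixKernel, Matrix.of_apply, transform_one hβ, transform_one hα,
      leftTransform_neg_eq_rightTransform hβ]
    rw [show -(y : ℂ) + -(x : ℂ) = -(x + y) by ring, div_neg]
    simp [mul_comm, sub_eq_add_neg]
  -- Here the pole 1 / (z - w) remains, but it is harmless at (-y, x), where z - w = -(x + y) is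
  -- nonzero; it supplies the subtracted term of the kernel.
  · refine hasValue_of_continuousAt (E := fun z w => 1 / (z - w) - ∑ j ∈ Finset.range N,
      leftTransform α (p j) z * rightTransform β (q j) w) ?_ ?_ ?_
    · intro z hz w hw hzw
      have h0 : z - w ≠ 0 := sub_ne_zero.2 hzw
      have h1 : ((Γ w)⁻¹ * Γ z) 1 1 = _ := hinv z hz w hw 1 1
      rw [h1]
      simp only [entry, Matrix.of_apply, Matrix.cons_val_zero, Matrix.cons_val_one]
      field_simp
    · have h1 := fun j => (hL y hy j).comp_of_eq (f := fun x : ℂ × ℂ => x.1)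
        (x := (-(y : ℂ), (x : ℂ))) continuousAt_fst rfl
      have h2 := fun j => (hR x hx j).comp_of_eq (f := fun x : ℂ × ℂ => x.2)
        (x := (-(y : ℂ), (x : ℂ))) continuousAt_snd rfl
      simp only [Function.comp_def] at h1 h2
      refine ContinuousAt.sub (ContinuousAt.div (by fun_prop) (by fun_prop) ?_) (by fun_prop)
      have : -(y : ℂ) - x = ((-(x + y) : ℝ) : ℂ) := by push_cast; ring
      simp only [this]
      exact_mod_cast (by linarith : -(x + y) < 0).ne
    · rw [H11_eq_sum hmα hα hmβ hβ hy hx]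
      rw [show -(y : ℂ) - (x : ℂ) = -(x + y) by ring, div_neg]
      ring
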